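/- **Notation.** For complex $a,q$ with $|q|<1$ put $(a;q)_\infty=\prod_{i\ge 0}(1-aq^i)$ and $(q)_\infty=(q;q)_\infty$. The crank generating function is $$C(x;q)=\frac{(q)_\infty}{(xq;q)_\infty\,(x^{-1}q;q)_\infty}.$$ For a real number $x$ let $((x))=x-\lfloor x\rfloor-\tfrac12$ if $x\notin\mathbb Z$ and $((x))=0$ if $x\in\mathbb Z$; put $s(h,k)=\sum_{\mu \bmod k}\left(\left(\frac{\mu}{k}\right)\right)\left(\left(\frac{h\mu}{k}\right)\right)$ and $\omega_{h,k}=e^{\pi i s(h,k)}$. For $\operatorname{Im}\tau>0$ and $q=e^{2\pi i\tau}$, real powers of $q$ are understood as $q^{s}=e^{2\pi i s\tau}$. For integers $a$ and $0<b<c$ put $$C(a,b,c;q)=\frac{i}{2(q)_\infty}\left(\sum_{m=0}^{\infty}\frac{(-1)^m e^{-\frac{\pi i a}{c}}q^{\frac{m(m+1)}{2}+\frac{b}{2c}}}{1-e^{-\frac{2\pi i a}{c}}q^{m+\frac bc}}-\sum_{m=1}^{\infty}\frac{(-1)^m e^{\frac{\pi i a}{c}}q^{\frac{m(m+1)}{2}-\frac{b}{2c}}}{1-e^{\frac{2\pi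 i a}{c}}q^{m-\frac bc}}\right).$$ **Proposition.** Let $0<a<c$ be coprime integers with $c$ odd, let $0\le h<k$ be coprime integers, and let $z\in\mathbb C$ with $\operatorname{Re}(z)>0$. Let $h'$ be an integer with $hh'\equiv-1\pmod k$ if $k$ is odd and $hh'\equiv-1\pmod{2k}$ if $k$ is even. Let $z^{1/2}$ be the principal square root, and let $q_1=e^{2\pi i\tau}$ with $\tau=\frac1k\left(h'+\frac iz\right)$. 1. If $c\mid k$, then $$C\left(e^{\frac{2\pi i a}{c}};e^{\frac{2\pi i}{k}(h+iz)}\right)=\frac{i\sin\left(\frac{\pi a}{c}\right)}{z^{1/2}\sin\left(\frac{\pi a h'}{c}\right)}(-1)^{ak+1}\,\omega_{h,k}\,e^{\frac{\pi}{12k}(z^{-1}-z)-\frac{\pi i a^2kh'}{c^2}}\;C\left(e^{\frac{2\pi i a h'}{c}};q_1\right).$$ 2. If $c\nmid k$ and $l$ is the unique integer with $0<l<c$ and $l\equiv ak\pmod c$, then $$C\left(e^{\frac{2\pi i a}{c}};e^{\frac{2\pi i}{k}(h+iz)}\right)=\frac{4i\sin\left(\frac{\pi a}{c}\right)\omega_{h,k}(-1)^{ak+l+1}}{z^{1/2}}\,e^{-\frac{\pi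 i a^2h'k}{c^2}+\frac{2\pi i h'la}{c^2}}\;q_1^{-\frac{l^2}{2c^2}}\,e^{\frac{\pi}{12k}(z^{-1}-z)}\;C(ah',l,c;q_1).$$ -/

import Mathlib

noncomputable section

namespace CrankTrafo

open Complex

/-- The infinite `q`-Pochhammer symbol `(a; q)_∞ = ∏_{i ≥ 0} (1 - a q^i)`. -/
def qPochInf (a q : ℂ) : ℂ := ∏' i : ℕ, (1 - a * q ^ i)

/-- The two-variable crank generating function
`C(x; q) = (q; q)_∞ / ((x q; q)_∞ (x⁻¹ q; q)_∞)`. -/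
def crankC (x q : ℂ) : ℂ :=
  qPochInf q q / (qPochInf (x * q) q * qPochInf (x⁻¹ * q) q)

open Classical in
/-- The sawtooth function `((x))`. -/
def sawtooth (x : ℝ) : ℝ :=
  if ∃ n : ℤ, x = n then 0 else x - ⌊x⌋ - 1 / 2

/-- The Dedekind sum `s(h, k) = ∑_{μ mod k} ((μ / k)) ((h μ / k))`. -/
def dedekindSum (h : ℤ) (k : ℕ) : ℝ :=
  ∑ μ ∈ Finset.range k, sawtooth ((μ : ℝ) / k) * sawtooth ((h : ℝ) * μ / k)

/-- The multiplier `ω_{h,k} = exp (π i s(h, k))`. -/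
def omega (h : ℤ) (k : ℕ) : ℂ := cexp (Real.pi * I * dedekindSum h k)

/-- The power `q ^ s` of `q = e^{2 π i τ}`, meaning `e^{2 π i s τ}` also for fractional `s`. -/
def qPow (τ s : ℂ) : ℂ := cexp (2 * Real.pi * I * s * τ)

/-- The function `C(a, b, c; q)` at `q = e^{2 π i τ}`; fractional powers of `q` are those
determined by `τ`. The second series, over `m ≥ 1`, is indexed by `m + 1` with `m ≥ 0`. -/
def crankLerch (a b : ℤ) (c : ℕ) (τ : ℂ) : ℂ :=
  I / (2 * qPochInf (qPow τ 1) (qPow τ 1)) *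
    ((∑' m : ℕ, (-1 : ℂ) ^ m * cexp (-(Real.pi * I * a / c)) *
          qPow τ ((m : ℂ) * (m + 1) / 2 + b / (2 * c)) /
        (1 - cexp (-(2 * Real.pi * I * a / c)) * qPow τ ((m : ℂ) + b / c))) -
      ∑' m : ℕ, (-1 : ℂ) ^ (m + 1) * cexp (Real.pi * I * a / c) *
          qPow τ (((m : ℂ) + 1) * (m + 2) / 2 - b / (2 * c)) /
        (1 - cexp (2 * Real.pi * I * a / c) * qPow τ ((m : ℂ) + 1 - b / c)))

end CrankTrafo

end

/-!
Write `e(u) = e^{2πiu}`, `q = e(τ)`, `τ = (h + iz) / k`, `τ₁ = (h' + i / z) / k`, and let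
`θ(u; τ) = sin (πu) (e(u) q; q)_∞ (e(-u) q; q)_∞ / (q)_∞²` (`thetaQuot`). Both sides of the claimed
formulas are reciprocals of `(q)_∞ θ`:

* `C(e(u); q) = sin (πu) / ((q)_∞ θ(u; τ))` by definition (`crankC_eq`);
* `C(a, b, c; q) = 1 / (4 (q)_∞ θ(a / c - (b / c) τ; τ))` (`crankLerch_eq`). The two series combine
  into the bilateral series `∑ (-1)^n q^{n(n+1)/2} / (1 - x q^n)`, which is the partial fraction
  expansion of a reciprocal theta function (`reciprocal_theta`). It is obtained from a finite
  expansion, an instance of Lagrange interpolation at the nodes `q^{-i}`, by dominated convergence.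

So the result is the modularity of `θ` and of `(q)_∞`, together with the quasi-periodicity of `θ`.
Up to a constant, `θ` is `ϑ / η³`, a Jacobi form of weight `-1` and index `1 / 2` without
multiplier. Its transformation law for an arbitrary matrix (`thetaQuot_cusp`) follows
from Liouville's theorem: both sides have the same simple zeros and the same factors of
automorphy, so their quotient is an entire elliptic function, and it equals `1` at the origin.

The root of unity `ω_{h,k}` and the square root come from `(q)_∞` alone, that is, from `η`.
Starting from `η(-1 / τ)`, the general law (`eta_cusp`) is proved by the Euclidean algorithm on
`(h, k)`; the multipliers multiply to `ω_{h,k}` by the reciprocity law for Dedekind sums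
(`dedekindSum_reciprocity`), which is proved by counting lattice points.

Finally `θ` is evaluated at `a / (c i z) = a h' / c - (a k / c) τ₁` (`crankC_cusp`). With
`a k = l + c n`, a shift by `n τ₁` leads to `a h' / c - (l / c) τ₁`, where `l = 0` if `c ∣ k`.
-/

noncomputable section

namespace CrankTrafo

open Complex Filter Topology

/-! ### Dedekind sums -/

lemma sawtooth_zero : sawtooth 0 = 0 := by
  unfold sawtooth
  rw [if_pos ⟨0, by simp⟩]

lemma sawtooth_add_int (x : ℝ) (n : ℤ) : sawtooth (x + n) = sawtooth x := by
  unfold sawtooth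
  have : (∃ m : ℤ, x + n = m) ↔ ∃ m : ℤ, x = m := by
    constructor
    · rintro ⟨m, hm⟩
      exact ⟨m - n, by push_cast; linarith⟩
    · rintro ⟨m, hm⟩
      exact ⟨m + n, by push_cast; linarith⟩
  by_cases hx : ∃ m : ℤ, x = m
  · rw [if_pos hx, if_pos (this.mpr hx)]
  · rw [if_neg hx, if_neg (fun h => hx (this.mp h)), Int.floor_add_intCast]
    push_cast
    ring

lemma sawtooth_neg (x : ℝ) : sawtooth (-x) = -sawtooth x := by
  unfold sawtooth
  have : (∃ m : ℤ, -x = m) ↔ ∃ m : ℤ, x = m := by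
    constructor
    · rintro ⟨m, hm⟩
      exact ⟨-m, by push_cast; linarith⟩
    · rintro ⟨m, hm⟩
      exact ⟨-m, by push_cast; linarith⟩
  by_cases h : ∃ m : ℤ, x = m
  · rw [if_pos h, if_pos (this.mpr h), neg_zero]
  · rw [if_neg h, if_neg (fun h' => h (this.mp h'))]
    have hf : ⌊-x⌋ = -⌊x⌋ - 1 := by
      rw [Int.floor_eq_iff]
      have h1 := Int.floor_le x
      have h2 := Int.lt_floor_add_one x
      have h3 : x ≠ ⌊x⌋ := fun h' => h ⟨_, h'⟩
      have h4 : (⌊x⌋ : ℝ) < x := lt_of_le_of_ne h1 h3.symm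
      push_cast
      constructor <;> linarith
    rw [hf]
    push_cast
    ring

lemma dedekindSum_add_mul (h n : ℤ) {k : ℕ} (hk : 0 < k) :
    dedekindSum (h + n * k) k = dedekindSum h k := by
  unfold dedekindSum
  refine Finset.sum_congr rfl fun μ _ => ?_
  have hk' : (k : ℝ) ≠ 0 := by positivity
  have : ((h + n * k : ℤ) : ℝ) * μ / k = (h : ℝ) * μ / k + ((n * μ : ℤ) : ℝ) := by
    push_cast
    field_simp
  rw [this, sawtooth_add_int]

lemma dedekindSum_neg (h : ℤ) (k : ℕ) : dedekindSum (-h) k = -dedekindSum h k := by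
  unfold dedekindSum
  rw [← Finset.sum_neg_distrib]
  refine Finset.sum_congr rfl fun μ _ => ?_
  have : ((-h : ℤ) : ℝ) * μ / k = -((h : ℝ) * μ / k) := by
    push_cast
    ring
  rw [this, sawtooth_neg]
  ring

lemma sawtooth_natCast_div {n k : ℕ} (hk : 0 < k) (hn : ¬ k ∣ n) :
    sawtooth ((n : ℝ) / k) = (n : ℝ) / k - (n / k : ℕ) - 1 / 2 := by
  unfold sawtooth
  have hk' : (k : ℝ) ≠ 0 := by positivity
  rw [if_neg, ← Nat.floor_div_eq_div (K := ℝ), ← natCast_floor_eq_intCast_floor (by positivity)]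
  · rintro ⟨m, hm⟩
    rw [div_eq_iff hk'] at hm
    apply hn
    have : (n : ℤ) = m * k := by exact_mod_cast hm
    exact Int.natCast_dvd_natCast.mp ⟨m, by rw [this]; ring⟩

/-- Multiplication by `h` permutes the residues modulo `k`. -/
lemma sum_range_mul_mod {h k : ℕ} (hcop : Nat.Coprime h k) (f : ℕ → ℝ) :
    ∑ μ ∈ Finset.range k, f (h * μ % k) = ∑ μ ∈ Finset.range k, f μ := by
  rcases Nat.eq_zero_or_pos k with rfl | hk
  · simp
  have hinj : Set.InjOn (fun μ => h * μ % k) (Finset.range k) := by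
    intro a ha b hb hab
    have hab' : h * a ≡ h * b [MOD k] := hab
    have := Nat.ModEq.cancel_left_of_coprime (by rw [Nat.gcd_comm]; exact hcop) hab'
    simp only [Finset.coe_range, Set.mem_Iio] at ha hb
    rwa [Nat.ModEq, Nat.mod_eq_of_lt ha, Nat.mod_eq_of_lt hb] at this
  have himg : (Finset.range k).image (fun μ => h * μ % k) = Finset.range k := by
    apply Finset.eq_of_subset_of_card_le
    · intro x hx
      obtain ⟨y, -, rfl⟩ := Finset.mem_image.mp hx
      exact Finset.mem_range.mpr (Nat.mod_lt _ hk)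
    · rw [Finset.card_image_of_injOn hinj]
  conv_rhs => rw [← himg]
  rw [Finset.sum_image hinj]

lemma sum_range_natCast (k : ℕ) : ∑ μ ∈ Finset.range k, (μ : ℝ) = k * (k - 1) / 2 := by
  induction k with
  | zero => simp
  | succ n ih =>
    rw [Finset.sum_range_succ, ih]
    push_cast
    ring

lemma sum_range_natCast_sq (k : ℕ) :
    ∑ μ ∈ Finset.range k, (μ : ℝ) ^ 2 = k * (k - 1) * (2 * k - 1) / 6 := by
  induction k with
  | zero => simp
  | succ n ih =>
    rw [Finset.sum_range_succ, ih]
    push_cast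
    ring

lemma natCast_mul_mod (h k μ : ℕ) :
    ((h * μ % k : ℕ) : ℝ) = h * μ - k * (h * μ / k : ℕ) := by
  have := Nat.mod_add_div (h * μ) k
  have h2 : ((h * μ % k : ℕ) : ℝ) + k * (h * μ / k : ℕ) = h * μ := by exact_mod_cast this
  linarith

lemma sum_mul_div {h k : ℕ} (hk : 0 < k) (hcop : Nat.Coprime h k) :
    ∑ μ ∈ Finset.range k, ((h * μ / k : ℕ) : ℝ) = (h - 1) * (k - 1) / 2 := by
  have h1 := sum_range_mul_mod hcop (fun n => (n : ℝ))
  simp only [natCast_mul_mod, Finset.sum_sub_distrib, ← Finset.mul_sum, sum_range_natCast] at h1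
  have hk' : (k : ℝ) ≠ 0 := by positivity
  apply mul_left_cancel₀ hk'
  linarith

/-- Comparison of the sums of squares of `h μ mod k = h μ - k ⌊h μ / k⌋` and of `μ`. -/
lemma sum_mul_div_sq {h k : ℕ} (hcop : Nat.Coprime h k) :
    (h : ℝ) ^ 2 * (k * (k - 1) * (2 * k - 1) / 6)
      - 2 * h * k * ∑ μ ∈ Finset.range k, (μ : ℝ) * (h * μ / k : ℕ)
      + k ^ 2 * ∑ μ ∈ Finset.range k, ((h * μ / k : ℕ) : ℝ) ^ 2
      = k * (k - 1) * (2 * k - 1) / 6 := by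
  have h1 := sum_range_mul_mod hcop (fun n => (n : ℝ) ^ 2)
  rw [← sum_range_natCast_sq]
  conv_rhs => rw [← h1]
  rw [Finset.mul_sum, Finset.mul_sum, Finset.mul_sum,
    ← Finset.sum_sub_distrib, ← Finset.sum_add_distrib]
  refine Finset.sum_congr rfl fun μ _ => ?_
  rw [natCast_mul_mod]
  ring

lemma sum_range_ite_le {f h : ℕ} (hf : f < h) :
    ∑ ν ∈ Finset.range h, (if ν ≤ f then 2 * (ν : ℝ) else 0) = f * (f + 1) := by
  rw [← Finset.sum_filter]
  have : (Finset.range h).filter (· ≤ f) = Finset.range (f + 1) := by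
    ext x
    simp only [Finset.mem_filter, Finset.mem_range]
    omega
  rw [this, ← Finset.mul_sum, sum_range_natCast]
  push_cast
  ring

lemma card_filter_le_mul_div {h k ν : ℕ} (hh : 0 < h) (hcop : Nat.Coprime h k)
    (hν0 : 0 < ν) (hν : ν < h) (hk : 0 < k) :
    (((Finset.range k).filter (fun μ => ν ≤ h * μ / k)).card : ℝ)
      = k - 1 - (k * ν / h : ℕ) := by
  have hnd : ¬ h ∣ k * ν := by
    intro hd
    exact absurd (Nat.le_of_dvd hν0 (hcop.dvd_of_dvd_mul_left hd)) (by omega)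
  have hlt : k * ν / h < k := by
    rw [Nat.div_lt_iff_lt_mul hh]
    exact Nat.mul_lt_mul_of_pos_left hν hk
  have : (Finset.range k).filter (fun μ => ν ≤ h * μ / k)
      = Finset.Ico (k * ν / h + 1) k := by
    ext μ
    simp only [Finset.mem_filter, Finset.mem_range, Finset.mem_Ico]
    rw [Nat.le_div_iff_mul_le hk, Nat.succ_le_iff, Nat.div_lt_iff_lt_mul hh]
    constructor
    · rintro ⟨h1, h2⟩
      refine ⟨lt_of_le_of_ne (by nlinarith) ?_, h1⟩
      intro h3
      exact hnd ⟨μ, by rw [h3]; ring⟩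
    · rintro ⟨h1, h2⟩
      exact ⟨h2, by nlinarith⟩
  rw [this, Nat.card_Ico, Nat.cast_sub (by omega)]
  push_cast
  ring

/-- Exchanging the order of summation in a count of lattice points below a line. -/
lemma sum_div_mul_succ {h k : ℕ} (hh : 0 < h) (hk : 0 < k) (hcop : Nat.Coprime h k) :
    ∑ μ ∈ Finset.range k, ((h * μ / k : ℕ) : ℝ) * ((h * μ / k : ℕ) + 1)
      = h * (h - 1) * (k - 1) - 2 * ∑ ν ∈ Finset.range h, (ν : ℝ) * (k * ν / h : ℕ) := by
  have h1 : ∀ μ ∈ Finset.range k, ((h * μ / k : ℕ) : ℝ) * ((h * μ / k : ℕ) + 1) =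
      ∑ ν ∈ Finset.range h, (if ν ≤ h * μ / k then 2 * (ν : ℝ) else 0) := by
    intro μ hμ
    rw [sum_range_ite_le]
    rw [Nat.div_lt_iff_lt_mul hk]
    exact Nat.mul_lt_mul_of_pos_left (Finset.mem_range.mp hμ) hh
  rw [Finset.sum_congr rfl h1, Finset.sum_comm]
  have h2 : ∀ ν ∈ Finset.range h,
      ∑ μ ∈ Finset.range k, (if ν ≤ h * μ / k then 2 * (ν : ℝ) else 0)
        = 2 * (k - 1) * ν - 2 * ((ν : ℝ) * (k * ν / h : ℕ)) := by
    intro ν hν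
    rcases Nat.eq_zero_or_pos ν with rfl | hν0
    · simp
    rw [← Finset.sum_filter, Finset.sum_const, nsmul_eq_mul,
      card_filter_le_mul_div hh hcop hν0 (Finset.mem_range.mp hν) hk]
    ring
  rw [Finset.sum_congr rfl h2, Finset.sum_sub_distrib, ← Finset.mul_sum, ← Finset.mul_sum,
    sum_range_natCast]
  ring

/-- The Dedekind sum in terms of `∑ μ ⌊h μ / k⌋`. -/
lemma dedekindSum_eq {h k : ℕ} (hk : 0 < k) (hcop : Nat.Coprime h k) :
    dedekindSum h k = h * (k - 1) * (2 * k - 1) / (6 * k)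
      - (∑ μ ∈ Finset.range k, (μ : ℝ) * (h * μ / k : ℕ)) / k
      - (k - 1) / 4 := by
  have hk' : (k : ℝ) ≠ 0 := by positivity
  -- The sawtooth function vanishes at `0`, where the formula valid off the integers would
  -- contribute `1 / 4`.
  have h1 : ∀ μ ∈ Finset.range k, sawtooth ((μ : ℝ) / k) * sawtooth (((h : ℤ) : ℝ) * μ / k)
      = ((μ : ℝ) / k - 1 / 2) * ((h : ℝ) * μ / k - (h * μ / k : ℕ) - 1 / 2)
        - (if μ = 0 then 1 / 4 else 0) := by
    intro μ hμ
    rcases Nat.eq_zero_or_pos μ with rfl | hμ0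
    · simp [sawtooth_zero]
      norm_num
    have hμk := Finset.mem_range.mp hμ
    have e1 := sawtooth_natCast_div (n := μ) hk
      (fun hd => absurd (Nat.le_of_dvd hμ0 hd) (by omega))
    have e2 := sawtooth_natCast_div (n := h * μ) hk
      (fun hd => absurd (Nat.le_of_dvd hμ0 (hcop.symm.dvd_of_dvd_mul_left hd)) (by omega))
    rw [Nat.div_eq_of_lt hμk] at e1
    push_cast at e1 e2 ⊢
    rw [e1, e2, if_neg (by omega)]
    ring
  unfold dedekindSum
  rw [Finset.sum_congr rfl h1, Finset.sum_sub_distrib, Finset.sum_ite_eq',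
    if_pos (Finset.mem_range.mpr hk)]
  have h2 : ∀ μ ∈ Finset.range k,
      ((μ : ℝ) / k - 1 / 2) * ((h : ℝ) * μ / k - (h * μ / k : ℕ) - 1 / 2)
      = (h : ℝ) / k ^ 2 * (μ : ℝ) ^ 2 - 1 / k * ((μ : ℝ) * (h * μ / k : ℕ))
        - (1 + h) / (2 * k) * μ + 1 / 2 * ((h * μ / k : ℕ) : ℝ) + 1 / 4 := by
    intro μ _
    field_simp
    ring
  rw [Finset.sum_congr rfl h2]
  simp only [Finset.sum_add_distrib, Finset.sum_sub_distrib, ← Finset.mul_sum,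
    sum_range_natCast, sum_range_natCast_sq, sum_mul_div hk hcop, Finset.sum_const,
    Finset.card_range, nsmul_eq_mul]
  field_simp
  ring

/-- **Reciprocity law** for Dedekind sums. -/
lemma dedekindSum_reciprocity {h k : ℕ} (hh : 0 < h) (hk : 0 < k) (hcop : Nat.Coprime h k) :
    dedekindSum h k + dedekindSum k h
      = -1 / 4 + ((h : ℝ) / k + k / h + 1 / (h * k)) / 12 := by
  have hh' : (h : ℝ) ≠ 0 := by positivity
  have hk' : (k : ℝ) ≠ 0 := by positivity
  rw [dedekindSum_eq hk hcop, dedekindSum_eq hh hcop.symm]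
  have e1 := sum_mul_div_sq hcop
  have e2 := sum_div_mul_succ hh hk hcop
  simp only [mul_add, Finset.sum_add_distrib, mul_one, sum_mul_div hk hcop, ← pow_two] at e2
  -- The two relations for the sum of squares `F` determine `X / k + Y / h`.
  set X := ∑ μ ∈ Finset.range k, (μ : ℝ) * (h * μ / k : ℕ)
  set Y := ∑ ν ∈ Finset.range h, (ν : ℝ) * (k * ν / h : ℕ)
  set F := ∑ μ ∈ Finset.range k, ((h * μ / k : ℕ) : ℝ) ^ 2
  have e3 : F = h * (h - 1) * (k - 1) - 2 * Y - (h - 1) * (k - 1) / 2 := by linarith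
  rw [e3] at e1
  have e4 : X = ((h : ℝ) ^ 2 * (k * (k - 1) * (2 * k - 1) / 6) - k * (k - 1) * (2 * k - 1) / 6
      + k ^ 2 * (h * (h - 1) * (k - 1) - 2 * Y - (h - 1) * (k - 1) / 2)) / (2 * h * k) := by
    rw [eq_div_iff (by positivity)]
    linarith
  rw [e4]
  field_simp
  ring

/-! ### The Dedekind eta function at a cusp -/

lemma sqrt_mul_of_arg {w τ : ℂ} (hw : w ≠ 0) (hτ : τ ≠ 0)
    (h : arg w + arg τ ∈ Set.Ioc (-Real.pi) Real.pi) :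
    Complex.sqrt (w * τ) = Complex.sqrt w * Complex.sqrt τ := by
  unfold Complex.sqrt
  rw [cpow_def_of_ne_zero hw, cpow_def_of_ne_zero hτ, cpow_def_of_ne_zero (mul_ne_zero hw hτ),
    ← Complex.exp_add, log_mul hw hτ h, add_mul]

lemma ne_zero_of_im_pos {w : ℂ} (hw : 0 < w.im) : w ≠ 0 := by
  rintro rfl
  simp at hw

lemma arg_bounds_of_re_pos {w : ℂ} (hw : 0 < w.re) :
    -(Real.pi / 2) < arg w ∧ arg w < Real.pi / 2 :=
  abs_lt.mp (abs_arg_lt_pi_div_two_iff.mpr (Or.inl hw))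

lemma sqrt_mul_of_re_pos {w τ : ℂ} (hw : 0 < w.re) (hτ : 0 < τ.im) (hwτ : 0 < (w * τ).re) :
    Complex.sqrt (w * τ) = Complex.sqrt w * Complex.sqrt τ := by
  have hw0 := ne_zero_of_re_pos hw
  have hτ0 := ne_zero_of_im_pos hτ
  apply sqrt_mul_of_arg hw0 hτ0
  obtain ⟨h1, h2⟩ := arg_bounds_of_re_pos hw
  have h3 : 0 ≤ arg τ := arg_nonneg_iff.mpr hτ.le
  have h4 := arg_le_pi τ
  have hpi := Real.pi_pos
  refine ⟨by linarith, ?_⟩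
  by_contra! h5
  have hcos : Real.cos (arg w + arg τ) < 0 :=
    Real.cos_neg_of_pi_div_two_lt_of_lt (by linarith) (by linarith)
  have : (w * τ).re = ‖w‖ * ‖τ‖ * Real.cos (arg w + arg τ) := by
    rw [mul_re, Real.cos_add, ← norm_mul_cos_arg w, ← norm_mul_cos_arg τ,
      ← norm_mul_sin_arg w, ← norm_mul_sin_arg τ]
    ring
  rw [this] at hwτ
  have : 0 < ‖w‖ * ‖τ‖ := by positivity
  nlinarith

lemma sqrt_mul_I {z : ℂ} (hz : 0 < z.re) :
    Complex.sqrt (z * I) = Complex.sqrt z * Complex.sqrt I := by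
  apply sqrt_mul_of_arg (ne_zero_of_re_pos hz) I_ne_zero
  obtain ⟨h1, h2⟩ := arg_bounds_of_re_pos hz
  have hpi := Real.pi_pos
  rw [arg_I]
  constructor <;> linarith

lemma sqrt_I_inv : (Complex.sqrt I)⁻¹ = cexp (-(Real.pi * I / 4)) := by
  rw [Complex.exp_neg]
  congr 1
  unfold Complex.sqrt
  rw [cpow_def_of_ne_zero I_ne_zero, log_I]
  congr 1
  ring

lemma eta_add_int (τ : ℂ) (n : ℤ) :
    ModularForm.eta (τ + n) = cexp (Real.pi * I * n / 12) * ModularForm.eta τ := by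
  unfold ModularForm.eta
  have h1 : ∀ j, ModularForm.eta_q j (τ + n) = ModularForm.eta_q j τ := by
    intro j
    unfold ModularForm.eta_q
    congr 1
    unfold Function.Periodic.qParam
    rw [Complex.exp_eq_exp_iff_exists_int]
    exact ⟨n, by simp; ring⟩
  simp only [h1]
  rw [← mul_assoc]
  congr 1
  unfold Function.Periodic.qParam
  rw [← Complex.exp_add]
  congr 1
  push_cast
  ring

lemma eta_neg_inv {τ : ℂ} (hτ : 0 < τ.im) :
    ModularForm.eta (-1 / τ)
      = cexp (-(Real.pi * I / 4)) * (Complex.sqrt τ * ModularForm.eta τ) := by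
  have := ModularForm.eta_comp_eq_csqrt_I_inv hτ
  rw [sqrt_I_inv] at this
  simpa using this

lemma im_cusp_pos {h z : ℂ} {k : ℕ} (hk : 0 < k) (hh : h.im = 0) (hz : 0 < z.re) :
    0 < ((h + I * z) / k).im := by
  have hk' : (0 : ℝ) < k := by exact_mod_cast hk
  rw [div_natCast_im]
  simp [hh]
  positivity

lemma inv_re_pos {z : ℂ} (hz : 0 < z.re) : 0 < (z⁻¹).re := by
  rw [inv_re]
  exact div_pos hz (normSq_pos.mpr (ne_zero_of_re_pos hz))

/-- The transformation law of `η` under an arbitrary element of `SL₂(ℤ)`, written in the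
variable `z` around the cusp `h / k`. The induction on `k` is the Euclidean algorithm: it
replaces `(h, k)` by `(-k, h)` through `τ ↦ -1 / τ`, and the multipliers fit together
by the reciprocity law for Dedekind sums. -/
theorem eta_cusp (k : ℕ) : 0 < k → ∀ h h' : ℤ, (k : ℤ) ∣ h * h' + 1 → ∀ z : ℂ, 0 < z.re →
    ModularForm.eta ((h' + I / z) / k) =
      omega h k * Complex.sqrt z * cexp (Real.pi * I * (h' - h) / (12 * k)) *
        ModularForm.eta ((h + I * z) / k) := by
  induction k using Nat.strong_induction_on with
  | _ k ih =>
  intro hk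
  have hk0 : (k : ℂ) ≠ 0 := by exact_mod_cast hk.ne'
  -- It suffices to treat `0 ≤ h < k`, as both sides are compatible with `h ↦ h + k`.
  suffices H : ∀ (r : ℕ) (h' : ℤ), r < k → (k : ℤ) ∣ r * h' + 1 → ∀ z : ℂ, 0 < z.re →
      ModularForm.eta ((h' + I / z) / k) =
      omega r k * Complex.sqrt z * cexp (Real.pi * I * (h' - r) / (12 * k)) *
        ModularForm.eta ((r + I * z) / k) by
    intro h h' hd z hz
    have hkz : (k : ℤ) ≠ 0 := by exact_mod_cast hk.ne'
    obtain ⟨r, hr⟩ := Int.eq_ofNat_of_zero_le (Int.emod_nonneg h hkz)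
    have hrk : r < k := by
      have := Int.emod_lt_of_pos h (by exact_mod_cast hk : (0 : ℤ) < k)
      omega
    have hh : h = r + (h / k) * k := by
      rw [← hr]
      linarith [Int.emod_add_mul_ediv h k, mul_comm (h / (k : ℤ)) k]
    set n := h / (k : ℤ)
    have hd' : (k : ℤ) ∣ r * h' + 1 := by
      have : (r : ℤ) * h' + 1 = h * h' + 1 - k * (n * h') := by
        rw [hh]
        ring
      rw [this]
      exact dvd_sub hd (Dvd.intro _ rfl)
    rw [H r h' hrk hd' z hz]
    have e1 : omega h k = omega r k := by
      unfold omega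
      rw [hh, dedekindSum_add_mul _ _ hk]
    have e2 : ((h : ℂ) + I * z) / k = (r + I * z) / k + n := by
      rw [hh]
      push_cast
      field_simp
      ring
    have e3 : cexp (Real.pi * I * (h' - r) / (12 * k)) =
        cexp (Real.pi * I * (h' - h) / (12 * k)) * cexp (Real.pi * I * n / 12) := by
      rw [← Complex.exp_add]
      congr 1
      rw [hh]
      push_cast
      field_simp
      ring
    rw [e1, e2, eta_add_int, e3]
    ring
  intro h h' hhk hd z hz
  have hz0 := ne_zero_of_re_pos hz
  rcases Nat.eq_zero_or_pos h with rfl | hh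
  · have hk1 : k = 1 := by
      have : (k : ℤ) ∣ 1 := by simpa using hd
      exact Nat.dvd_one.mp (by exact_mod_cast this)
    subst hk1
    have e0 : omega (0 : ℕ) 1 = 1 := by
      simp [omega, dedekindSum, sawtooth_zero]
    have e1 : ((h' : ℂ) + I / z) / (1 : ℕ) = -1 / (z * I) + h' := by
      push_cast
      field_simp
      linear_combination I_sq
    have e2 : ((0 : ℕ) + I * z) / ((1 : ℕ) : ℂ) = z * I := by
      push_cast
      ring
    rw [e0, e1, eta_add_int, eta_neg_inv (by simpa using hz), e2, sqrt_mul_I hz, ← sqrt_I_inv]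
    have : Complex.sqrt I ≠ 0 := by
      unfold Complex.sqrt
      simp
    have e3 : cexp (Real.pi * I * (h' - (0 : ℕ)) / (12 * (1 : ℕ)))
        = cexp (Real.pi * I * h' / 12) := by
      simp
    rw [e3]
    field_simp
  · have hh0 : (h : ℂ) ≠ 0 := by exact_mod_cast hh.ne'
    obtain ⟨k', hk'⟩ := hd
    have hcop : Nat.Coprime h k := by
      rw [← Nat.isCoprime_iff_coprime]
      exact ⟨-h', k', by linarith⟩
    -- With `w = z / τ` one has `-1 / τ = (-k + i w) / h` and `τ₁ = (k' + i / w) / h`.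
    set τ : ℂ := (h + I * z) / k with hτ
    have hτim : 0 < τ.im := im_cusp_pos hk (by simp) hz
    have hτ0 := ne_zero_of_im_pos hτim
    have hhz0 : (h : ℂ) + I * z ≠ 0 := by
      intro h0
      rw [hτ, h0] at hτ0
      simp at hτ0
    set w : ℂ := z / τ with hw
    have hwre : 0 < w.re := by
      have h1 : w⁻¹ = (h * z⁻¹ + I) / k := by
        rw [hw, hτ]
        field_simp
      have h2 : 0 < (w⁻¹).re := by
        rw [h1, div_natCast_re]
        have := inv_re_pos hz
        have hhR : (0 : ℝ) < h := by exact_mod_cast hh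
        have hkR : (0 : ℝ) < k := by exact_mod_cast hk
        have : ((h : ℂ) * z⁻¹ + I).re = h * (z⁻¹).re := by simp [-inv_re]
        rw [this]
        positivity
      simpa using inv_re_pos h2
    have hwτ : w * τ = z := div_mul_cancel₀ z hτ0
    have key := ih h hhk hh (-k) k' ⟨-h', by linarith⟩ w hwre
    have e1 : ((k' : ℂ) + I / w) / h = (h' + I / z) / k := by
      have hkc : (h : ℂ) * h' + 1 = k * k' := by exact_mod_cast hk'
      rw [hw, hτ]
      field_simp
      linear_combination (-z) * hkc + z * I_sq
    have e2 : (((-k : ℤ) : ℂ) + I * w) / h = -1 / τ := by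
      rw [hw, hτ]
      push_cast
      field_simp
      ring
    rw [e1, e2, eta_neg_inv hτim] at key
    rw [key, ← hwτ, sqrt_mul_of_re_pos hwre hτim (by rw [hwτ]; exact hz)]
    -- This identity of multipliers is the reciprocity law.
    have e3 : omega (-k : ℤ) h * cexp (Real.pi * I * (k' - ((-k : ℤ) : ℂ)) / (12 * h))
        * cexp (-(Real.pi * I / 4))
        = omega h k * cexp (Real.pi * I * (h' - h) / (12 * k)) := by
      unfold omega
      rw [← Complex.exp_add, ← Complex.exp_add, ← Complex.exp_add, dedekindSum_neg]
      congr 1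
      have hrec := dedekindSum_reciprocity hh hk hcop
      have hrec' : (dedekindSum h k : ℂ) = -1 / 4 + ((h : ℂ) / k + k / h + 1 / (h * k)) / 12
          - (dedekindSum k h : ℂ) := by
        rw [eq_sub_iff_add_eq, ← ofReal_add, hrec]
        push_cast
        ring
      rw [hrec']
      have hkc : (h : ℂ) * h' + 1 = k * k' := by exact_mod_cast hk'
      push_cast
      field_simp
      linear_combination (-4) * hkc
    linear_combination (Complex.sqrt w * Complex.sqrt τ * ModularForm.eta τ) * e3

/-! ### The theta quotient -/

lemma summable_norm_mul_pow (a : ℂ) {q : ℂ} (hq : ‖q‖ < 1) :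
    Summable fun i : ℕ => ‖-(a * q ^ i)‖ := by
  simp only [norm_neg, norm_mul, norm_pow]
  exact (summable_geometric_of_lt_one (norm_nonneg _) hq).mul_left _

lemma multipliable_qPochInf (a : ℂ) {q : ℂ} (hq : ‖q‖ < 1) :
    Multipliable fun i : ℕ => 1 - a * q ^ i := by
  simpa only [sub_eq_add_neg] using multipliable_one_add_of_summable (summable_norm_mul_pow a hq)

lemma qPochInf_eq_mul (a : ℂ) {q : ℂ} (hq : ‖q‖ < 1) :
    qPochInf a q = (1 - a) * qPochInf (a * q) q := by
  have h : ∀ i : ℕ, 1 - a * q ^ (i + 1) = 1 - a * q * q ^ i := fun i => by ring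
  unfold qPochInf
  rw [tprod_eq_zero_mul']
  · simp only [h, pow_zero, mul_one]
  · simpa only [h] using multipliable_qPochInf (a * q) hq

lemma qPochInf_ne_zero {a q : ℂ} (hq : ‖q‖ < 1) (h : ∀ i : ℕ, a * q ^ i ≠ 1) :
    qPochInf a q ≠ 0 := by
  unfold qPochInf
  simp only [sub_eq_add_neg]
  refine tprod_one_add_ne_zero_of_summable (fun i => ?_) (summable_norm_mul_pow a hq)
  rw [← sub_eq_add_neg, sub_ne_zero]
  exact (h i).symm

lemma differentiable_qPochInf {q : ℂ} (hq : ‖q‖ < 1) :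
    Differentiable ℂ fun a => qPochInf a q := by
  intro a₀
  have hb : Summable fun i : ℕ => (‖a₀‖ + 1) * ‖q‖ ^ i :=
    (summable_geometric_of_lt_one (norm_nonneg _) hq).mul_left _
  have h := hb.hasProdLocallyUniformlyOn_nat_one_add
    (f := fun (i : ℕ) (a : ℂ) => -(a * q ^ i))
    (K := Metric.ball (0 : ℂ) (‖a₀‖ + 1)) Metric.isOpen_ball
    (.of_forall fun n x hx => by
      rw [mem_ball_zero_iff] at hx
      rw [norm_neg, norm_mul, norm_pow]
      gcongr) (fun n => by fun_prop)
  have hd := h.differentiableOn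
    (.of_forall fun _ => by
      simpa [Finset.prod_fn] using DifferentiableOn.finsetProd (fun _ _ => by fun_prop))
    Metric.isOpen_ball
  have := hd.differentiableAt (Metric.isOpen_ball.mem_nhds
    (mem_ball_zero_iff.mpr (lt_add_one ‖a₀‖)))
  simpa only [qPochInf, sub_eq_add_neg] using this

/-- The exponential `e(u) = e^{2 π i u}`. -/
def expI (u : ℂ) : ℂ := cexp (2 * Real.pi * I * u)

lemma expI_ne_zero (u : ℂ) : expI u ≠ 0 := Complex.exp_ne_zero _

lemma expI_add (u v : ℂ) : expI (u + v) = expI u * expI v := by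
  unfold expI
  rw [← Complex.exp_add]
  ring_nf

lemma expI_neg (u : ℂ) : expI (-u) = (expI u)⁻¹ := by
  unfold expI
  rw [← Complex.exp_neg]
  ring_nf

lemma expI_zero : expI 0 = 1 := by simp [expI]

lemma expI_one : expI 1 = 1 := by simp [expI]

lemma expI_eq_one_iff (u : ℂ) : expI u = 1 ↔ ∃ n : ℤ, u = n := by
  unfold expI
  rw [Complex.exp_eq_one_iff]
  have h : (2 * Real.pi * I : ℂ) ≠ 0 := by simp [Real.pi_ne_zero]
  refine exists_congr fun n => ⟨fun e => ?_, fun e => ?_⟩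
  · apply mul_left_cancel₀ h
    rw [e]
    ring
  · rw [e]
    ring

lemma expI_pow (u : ℂ) (n : ℕ) : expI u ^ n = expI (n * u) := by
  unfold expI
  rw [← Complex.exp_nat_mul]
  ring_nf

lemma norm_expI (u : ℂ) : ‖expI u‖ = Real.exp (-(2 * Real.pi * u.im)) := by
  unfold expI
  rw [Complex.norm_exp]
  congr 1
  simp

lemma norm_expI_lt_one {τ : ℂ} (hτ : 0 < τ.im) : ‖expI τ‖ < 1 := by
  rw [norm_expI, Real.exp_lt_one_iff]
  have := Real.pi_pos
  simp only [Left.neg_neg_iff]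
  positivity

@[fun_prop]
lemma differentiable_expI : Differentiable ℂ expI := by
  unfold expI
  fun_prop

/-- Euler's product `(q; q)_∞` at `q = e(τ)`. -/
def eulerProd (τ : ℂ) : ℂ := qPochInf (expI τ) (expI τ)

lemma eulerProd_ne_zero {τ : ℂ} (hτ : 0 < τ.im) : eulerProd τ ≠ 0 := by
  refine qPochInf_ne_zero (norm_expI_lt_one hτ) fun i h => ?_
  rw [← pow_succ'] at h
  have h1 := congrArg norm h
  rw [norm_pow, norm_one] at h1
  exact (pow_lt_one₀ (norm_nonneg _) (norm_expI_lt_one hτ) (Nat.succ_ne_zero i)).ne h1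

lemma eta_eq_eulerProd (τ : ℂ) :
    ModularForm.eta τ = cexp (Real.pi * I * τ / 12) * eulerProd τ := by
  unfold ModularForm.eta eulerProd qPochInf
  congr 1
  · unfold Function.Periodic.qParam
    congr 1
    push_cast
    ring
  · refine tprod_congr fun i => ?_
    rw [ModularForm.eta_q_eq_pow, ← pow_succ']
    rfl

/-- The product `sin (π u) (x q; q)_∞ (x⁻¹ q; q)_∞ / (q; q)_∞²` with `x = e(u)`, `q = e(τ)`. Up to
a constant factor this is the quotient `ϑ(u; τ) / η(τ)³` of Jacobi's odd theta function, a Jacobi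
form of weight `-1` and index `1 / 2` whose transformation law involves no root of unity. -/
def thetaQuot (τ u : ℂ) : ℂ :=
  Complex.sin (Real.pi * u) *
    (qPochInf (expI u * expI τ) (expI τ) * qPochInf ((expI u)⁻¹ * expI τ) (expI τ) /
      eulerProd τ ^ 2)

lemma crankC_eq {τ u : ℂ} (hτ : 0 < τ.im) (hu : Complex.sin (Real.pi * u) ≠ 0) :
    crankC (expI u) (expI τ) = Complex.sin (Real.pi * u) / (eulerProd τ * thetaQuot τ u) := by
  unfold crankC thetaQuot
  have h := eulerProd_ne_zero hτ
  change eulerProd τ / _ = _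
  set P := qPochInf (expI u * expI τ) (expI τ) * qPochInf ((expI u)⁻¹ * expI τ) (expI τ)
  rcases eq_or_ne P 0 with hP | hP
  · simp [hP]
  · field_simp

lemma sin_pi_mul (u : ℂ) :
    Complex.sin (Real.pi * u) = expI (u / 2) * (1 - (expI u)⁻¹) / (2 * I) := by
  have h : expI u = expI (u / 2) * expI (u / 2) := by
    rw [← expI_add]
    ring_nf
  have h1 : Complex.sin (Real.pi * u) = (expI (-(u / 2)) - expI (u / 2)) * I / 2 := by
    unfold Complex.sin expI
    ring_nf
  rw [h1, h, expI_neg]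
  have := expI_ne_zero (u / 2)
  field_simp
  rw [I_sq]
  ring

lemma thetaQuot_add_one (τ u : ℂ) : thetaQuot τ (u + 1) = -thetaQuot τ u := by
  unfold thetaQuot
  rw [expI_add, expI_one, mul_one, mul_add, mul_one, Complex.sin_add_pi]
  ring

lemma thetaQuot_add_tau {τ : ℂ} (hτ : 0 < τ.im) (u : ℂ) :
    thetaQuot τ (u + τ) = -cexp (-(Real.pi * I * τ) - 2 * Real.pi * I * u) * thetaQuot τ u := by
  have hq := norm_expI_lt_one hτ
  have hx := expI_ne_zero u
  have hq0 := expI_ne_zero τ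
  unfold thetaQuot
  rw [sin_pi_mul, sin_pi_mul, expI_add u τ, qPochInf_eq_mul (expI u * expI τ) hq]
  have e1 : (expI u * expI τ)⁻¹ * expI τ = (expI u)⁻¹ := by field_simp
  have e2 : cexp (-(Real.pi * I * τ) - 2 * Real.pi * I * u)
      = (expI (u / 2))⁻¹ * (expI (u / 2))⁻¹ * (expI (τ / 2))⁻¹ := by
    rw [← expI_neg, ← expI_neg, ← expI_add, ← expI_add]
    unfold expI
    ring_nf
  have e3 : expI ((u + τ) / 2) = expI (u / 2) * expI (τ / 2) := by
    rw [← expI_add]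
    ring_nf
  have e4 : expI u = expI (u / 2) * expI (u / 2) := by
    rw [← expI_add]
    ring_nf
  have e5 : expI τ = expI (τ / 2) * expI (τ / 2) := by
    rw [← expI_add]
    ring_nf
  rw [e1, qPochInf_eq_mul (expI u)⁻¹ hq, e2, e3]
  generalize qPochInf (expI u * expI τ * expI τ) (expI τ) = A
  generalize qPochInf ((expI u)⁻¹ * expI τ) (expI τ) = B
  rw [e4, e5]
  have h1 := expI_ne_zero (u / 2)
  have h2 := expI_ne_zero (τ / 2)
  field_simp
  ring

lemma thetaQuot_add_int (τ u : ℂ) (n : ℤ) :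
    thetaQuot τ (u + n) = cexp (Real.pi * I * n) * thetaQuot τ u := by
  have h1 : ∀ u, thetaQuot τ (u - 1) = -thetaQuot τ u := fun u => by
    rw [eq_neg_iff_add_eq_zero, ← sub_add_cancel u 1, thetaQuot_add_one, sub_add_cancel]
    ring
  induction n using Int.induction_on with
  | zero => simp
  | succ n ih =>
    push_cast at ih ⊢
    rw [← add_assoc, thetaQuot_add_one, ih, mul_add, Complex.exp_add, mul_one, Complex.exp_pi_mul_I]
    ring
  | pred n ih =>
    push_cast at ih ⊢
    rw [← add_sub_assoc, h1, ih, mul_sub, Complex.exp_sub, mul_one, Complex.exp_pi_mul_I]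
    ring

lemma thetaQuot_add_mul_tau {τ : ℂ} (hτ : 0 < τ.im) (u : ℂ) (m : ℤ) :
    thetaQuot τ (u + m * τ) =
      cexp (Real.pi * I * m - Real.pi * I * m ^ 2 * τ - 2 * Real.pi * I * m * u) *
        thetaQuot τ u := by
  have hm : ∀ (x : ℂ), -cexp x = cexp (Real.pi * I + x) := fun x => by
    rw [Complex.exp_add, Complex.exp_pi_mul_I]
    ring
  induction m using Int.induction_on with
  | zero => simp
  | succ n ih =>
    push_cast at ih ⊢
    rw [add_one_mul, ← add_assoc, thetaQuot_add_tau hτ, ih, hm, ← mul_assoc, ← Complex.exp_add]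
    congr 2
    ring
  | pred n ih =>
    push_cast at ih ⊢
    have h := thetaQuot_add_tau hτ (u + (-(n : ℂ) - 1) * τ)
    rw [show u + (-(n : ℂ) - 1) * τ + τ = u + -n * τ by ring, ih, hm] at h
    apply mul_left_cancel₀ (Complex.exp_ne_zero
      (Real.pi * I + (-(Real.pi * I * τ) - 2 * Real.pi * I * (u + (-(n : ℂ) - 1) * τ))))
    rw [← h, ← mul_assoc, ← Complex.exp_add]
    congr 2
    ring

/-- The factors of automorphy of `thetaQuot` for the lattice `ℤ τ + ℤ`. -/
lemma thetaQuot_add_lattice {τ : ℂ} (hτ : 0 < τ.im) (u : ℂ) (m n : ℤ) :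
    thetaQuot τ (u + (m * τ + n)) =
      cexp (Real.pi * I * (m + n) - Real.pi * I * m ^ 2 * τ - 2 * Real.pi * I * m * u) *
        thetaQuot τ u := by
  rw [← add_assoc, thetaQuot_add_int, thetaQuot_add_mul_tau hτ, ← mul_assoc, ← Complex.exp_add]
  congr 2
  ring

lemma thetaQuot_zero (τ : ℂ) : thetaQuot τ 0 = 0 := by simp [thetaQuot]

lemma differentiable_pochhammer_expI {τ : ℂ} (hτ : 0 < τ.im) :
    Differentiable ℂ fun u => qPochInf (expI u * expI τ) (expI τ) *
      qPochInf ((expI u)⁻¹ * expI τ) (expI τ) / eulerProd τ ^ 2 := by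
  have hq := norm_expI_lt_one hτ
  have h1 : Differentiable ℂ fun u => qPochInf (expI u * expI τ) (expI τ) :=
    (differentiable_qPochInf hq).comp (by fun_prop)
  have h2 : Differentiable ℂ fun u => qPochInf ((expI u)⁻¹ * expI τ) (expI τ) := by
    simp only [← expI_neg]
    exact (differentiable_qPochInf hq).comp (by fun_prop)
  exact (h1.mul h2).div_const _

lemma differentiable_thetaQuot {τ : ℂ} (hτ : 0 < τ.im) : Differentiable ℂ (thetaQuot τ) :=
  Differentiable.mul (by fun_prop) (differentiable_pochhammer_expI hτ)

lemma hasDerivAt_thetaQuot_zero {τ : ℂ} (hτ : 0 < τ.im) :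
    HasDerivAt (thetaQuot τ) Real.pi 0 := by
  have h1 : HasDerivAt (fun u : ℂ => Complex.sin (Real.pi * u)) Real.pi 0 := by
    have : HasDerivAt (fun u : ℂ => (Real.pi : ℂ) * u) (Real.pi * 1) 0 :=
      (hasDerivAt_id _).const_mul _
    simpa using this.csin
  have h2 := (differentiable_pochhammer_expI hτ 0).hasDerivAt
  have h3 := h1.mul h2
  have h0 := eulerProd_ne_zero hτ
  convert! h3 using 1
  simp only [expI_zero, one_mul, inv_one, mul_zero, Complex.sin_zero, zero_mul, add_zero]
  change _ = _ * (eulerProd τ * eulerProd τ / _)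
  field_simp

lemma thetaQuot_lattice {τ : ℂ} (hτ : 0 < τ.im) (m n : ℤ) : thetaQuot τ (m * τ + n) = 0 := by
  have := thetaQuot_add_lattice hτ 0 m n
  rwa [thetaQuot_zero, mul_zero, zero_add] at this

lemma deriv_thetaQuot_lattice {τ : ℂ} (hτ : 0 < τ.im) (m n : ℤ) :
    deriv (thetaQuot τ) (m * τ + n) ≠ 0 := by
  have h1 : HasDerivAt (fun u : ℂ =>
      cexp (Real.pi * I * (m + n) - Real.pi * I * m ^ 2 * τ - 2 * Real.pi * I * m * u) *
        thetaQuot τ u) _ 0 :=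
    (DifferentiableAt.hasDerivAt (by fun_prop)).mul (hasDerivAt_thetaQuot_zero hτ)
  simp only [← thetaQuot_add_lattice hτ, thetaQuot_zero, mul_zero, zero_add] at h1
  have h2 : deriv (thetaQuot τ) (m * τ + n) = deriv (fun u => thetaQuot τ (u + (m * τ + n))) 0 := by
    rw [deriv_comp_add_const, zero_add]
  rw [h2, h1.deriv]
  exact mul_ne_zero (Complex.exp_ne_zero _) (by simp [Real.pi_ne_zero])

lemma thetaQuot_eq_zero {τ u : ℂ} (hτ : 0 < τ.im) (h : thetaQuot τ u = 0) :
    ∃ m n : ℤ, u = m * τ + n := by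
  have hq := norm_expI_lt_one hτ
  unfold thetaQuot at h
  rcases mul_eq_zero.mp h with h | h
  · obtain ⟨n, hn⟩ := Complex.sin_eq_zero_iff.mp h
    refine ⟨0, n, ?_⟩
    have hpi : (Real.pi : ℂ) ≠ 0 := by simp [Real.pi_ne_zero]
    apply mul_left_cancel₀ hpi
    rw [hn]
    push_cast
    ring
  · have h0 := eulerProd_ne_zero hτ
    rcases mul_eq_zero.mp ((div_eq_zero_iff.mp h).resolve_right (pow_ne_zero 2 h0)) with h | h
    · by_contra hcon
      refine qPochInf_ne_zero hq (fun i hi => hcon ?_) h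
      rw [mul_assoc, ← pow_succ', expI_pow, ← expI_add, expI_eq_one_iff] at hi
      obtain ⟨n, hn⟩ := hi
      exact ⟨-(i + 1), n, by push_cast at hn ⊢; linear_combination hn⟩
    · by_contra hcon
      refine qPochInf_ne_zero hq (fun i hi => hcon ?_) h
      rw [mul_assoc, ← pow_succ', expI_pow, ← expI_neg, ← expI_add, expI_eq_one_iff] at hi
      obtain ⟨n, hn⟩ := hi
      exact ⟨i + 1, -n, by push_cast at hn ⊢; linear_combination -hn⟩

/-- A quotient of entire functions is entire if the zeros of the denominator are simple
and are zeros of the numerator. -/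
lemma exists_differentiable_quotient {f g : ℂ → ℂ} (hf : Differentiable ℂ f)
    (hg : Differentiable ℂ g) (hsimple : ∀ u, f u = 0 → deriv f u ≠ 0)
    (hzero : ∀ u, f u = 0 → g u = 0) :
    ∃ H : ℂ → ℂ, Differentiable ℂ H ∧ ∀ u, g u = H u * f u := by
  classical
  refine ⟨fun u => if f u = 0 then deriv g u / deriv f u else g u / f u, fun a => ?_, fun u => ?_⟩
  · by_cases ha : f a = 0
    · have hdf : DifferentiableAt ℂ (dslope f a) a :=
        ((differentiableOn_dslope Filter.univ_mem).mpr hf.differentiableOn).differentiableAt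
          Filter.univ_mem
      have hdg : DifferentiableAt ℂ (dslope g a) a :=
        ((differentiableOn_dslope Filter.univ_mem).mpr hg.differentiableOn).differentiableAt
          Filter.univ_mem
      have hne : dslope f a a ≠ 0 := by
        rw [dslope_same]
        exact hsimple a ha
      refine (hdg.div hdf hne).congr_of_eventuallyEq ?_
      filter_upwards [hdf.continuousAt.eventually_ne hne] with u hu
      rcases eq_or_ne u a with rfl | hua
      · simp [ha]
      · have hua' : u - a ≠ 0 := sub_ne_zero.mpr hua
        have e1 : f u = (u - a) * dslope f a u := by
          have := sub_smul_dslope f a u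
          rw [ha, sub_zero, smul_eq_mul] at this
          exact this.symm
        have e2 : g u = (u - a) * dslope g a u := by
          have := sub_smul_dslope g a u
          rw [hzero a ha, sub_zero, smul_eq_mul] at this
          exact this.symm
        have hfu : f u ≠ 0 := by
          rw [e1]
          exact mul_ne_zero hua' hu
        simp only [if_neg hfu, Pi.div_apply]
        rw [e1, e2, mul_div_mul_left _ _ hua']
    · refine ((hg a).div (hf a) ha).congr_of_eventuallyEq ?_
      filter_upwards [(hf a).continuousAt.eventually_ne ha] with u hu
      simp [if_neg hu]
  · by_cases hu : f u = 0
    · rw [hu, mul_zero, hzero u hu]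
    · simp only [if_neg hu]
      rw [div_mul_cancel₀ _ hu]

/-- An entire function with the two periods `1` and `τ` is constant. -/
lemma eq_const_of_doubly_periodic {H : ℂ → ℂ} {τ : ℂ} (hτ : 0 < τ.im) (hH : Differentiable ℂ H)
    (h1 : ∀ u, H (u + 1) = H u) (h2 : ∀ u, H (u + τ) = H u) (u v : ℂ) : H u = H v := by
  apply hH.apply_eq_apply_of_bounded
  have hp1 : Function.Periodic H 1 := h1
  have hp2 : Function.Periodic H τ := h2
  let Φ : ℝ × ℝ → ℂ := fun p => H (p.1 + p.2 * τ)
  have hΦ : Continuous Φ := hH.continuous.comp (by fun_prop)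
  have hc : IsCompact (Φ '' (Set.Icc 0 1 ×ˢ Set.Icc 0 1)) :=
    (isCompact_Icc.prod isCompact_Icc).image hΦ
  refine hc.isBounded.subset ?_
  rintro _ ⟨w, rfl⟩
  set t : ℝ := w.im / τ.im with ht
  set s : ℝ := w.re - t * τ.re with hs
  have hw : w = s + t * τ := by
    apply Complex.ext
    · simp [hs]
    · simp [ht, hτ.ne']
  refine ⟨(Int.fract s, Int.fract t), ⟨⟨Int.fract_nonneg _, (Int.fract_lt_one _).le⟩,
    ⟨Int.fract_nonneg _, (Int.fract_lt_one _).le⟩⟩, ?_⟩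
  have e : w = ((Int.fract s : ℝ) + (Int.fract t : ℝ) * τ) + ⌊s⌋ * (1 : ℂ) + ⌊t⌋ * τ := by
    conv_lhs => rw [hw, ← Int.floor_add_fract s, ← Int.floor_add_fract t]
    push_cast
    ring
  rw [e, (hp2.int_mul _) _, (hp1.int_mul _) _]

/-- Two entire functions with the same factors of automorphy under `u ↦ u + 1` and `u ↦ u + τ`
are proportional as soon as the zeros of one are simple and are zeros of the other. -/
lemma eq_const_mul_of_quasiperiodic {f g E₁ E₂ : ℂ → ℂ} {τ : ℂ} (hτ : 0 < τ.im)
    (hf : Differentiable ℂ f) (hg : Differentiable ℂ g)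
    (hsimple : ∀ u, f u = 0 → deriv f u ≠ 0) (hzero : ∀ u, f u = 0 → g u = 0)
    (hE₁ : ∀ u, E₁ u ≠ 0) (hE₂ : ∀ u, E₂ u ≠ 0)
    (hf₁ : ∀ u, f (u + 1) = E₁ u * f u) (hg₁ : ∀ u, g (u + 1) = E₁ u * g u)
    (hf₂ : ∀ u, f (u + τ) = E₂ u * f u) (hg₂ : ∀ u, g (u + τ) = E₂ u * g u) :
    ∃ c : ℂ, ∀ u, g u = c * f u := by
  obtain ⟨H, hH, hgH⟩ := exists_differentiable_quotient hf hg hsimple hzero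
  have hper : ∀ (ω : ℂ) (E : ℂ → ℂ), (∀ u, E u ≠ 0) → (∀ u, f (u + ω) = E u * f u) →
      (∀ u, g (u + ω) = E u * g u) → ∀ u, H (u + ω) = H u := by
    intro ω E hE hfE hgE
    have hd : Differentiable ℂ fun u => H (u + ω) - H u :=
      (hH.comp (by fun_prop : Differentiable ℂ fun u : ℂ => u + ω)).sub hH
    have hmul : ∀ u ∈ Set.univ, (H (u + ω) - H u) * f u = 0 := by
      intro u _
      apply mul_left_cancel₀ (hE u)
      have h1 := hgE u
      rw [hgH, hfE, hgH u] at h1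
      linear_combination h1
    rcases AnalyticOnNhd.eq_zero_or_eq_zero_of_mul_eq_zero
      (fun u _ => hd.analyticAt u) (fun u _ => hf.analyticAt u) hmul isPreconnected_univ with h | h
    · exact fun u => sub_eq_zero.mp (h u trivial)
    · exfalso
      have hf0 : f = fun _ => 0 := funext fun u => h u trivial
      exact hsimple 0 (h 0 trivial) (by simp [hf0])
  refine ⟨H 0, fun u => ?_⟩
  rw [hgH u, eq_const_of_doubly_periodic hτ hH (hper 1 E₁ hE₁ hf₁ hg₁) (hper τ E₂ hE₂ hf₂ hg₂) u 0]

/-! ### Modular transformation of the theta quotient and of Euler's product -/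

lemma exp_pi_mul_I_parity {a b : ℤ} (h : Odd a ∨ Odd b) :
    cexp (Real.pi * I * (a - b - a * b)) = -1 := by
  obtain ⟨n, hn⟩ : ∃ n : ℤ, a - b - a * b = 2 * n + 1 := by
    rcases h with ⟨m, rfl⟩ | ⟨m, rfl⟩
    · exact ⟨m - b - m * b, by ring⟩
    · exact ⟨-m - a * m - 1, by ring⟩
  have hn' : (a : ℂ) - b - a * b = 2 * n + 1 := by exact_mod_cast hn
  rw [hn', show (Real.pi * I * (2 * n + 1) : ℂ) = n * (2 * Real.pi * I) + Real.pi * I by ring,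
    Complex.exp_add, Complex.exp_int_mul_two_pi_mul_I, Complex.exp_pi_mul_I, one_mul]

/-- The transformation law of `ϑ / η³` under an arbitrary element of `SL₂(ℤ)`, written in the
variable `z` around the cusp `h / k`. Both sides are entire in `v`, have the same factors of
automorphy and the same simple zeros, hence are proportional; comparing the derivatives at `0`
gives the constant. -/
theorem thetaQuot_cusp {k : ℕ} (hk : 0 < k) {h h' k' : ℤ} (hd : h * h' + 1 = k * k') {z : ℂ}
    (hz : 0 < z.re) (v : ℂ) :
    thetaQuot ((h + I * z) / k) (I * z * v) =
      I * z * cexp (Real.pi * k * z * v ^ 2) * thetaQuot ((h' + I / z) / k) v := by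
  have hk0 : (k : ℂ) ≠ 0 := by exact_mod_cast hk.ne'
  have hz0 := ne_zero_of_re_pos hz
  have hIz : I * z ≠ 0 := mul_ne_zero I_ne_zero hz0
  have hdc : (h : ℂ) * h' + 1 = k * k' := by exact_mod_cast hd
  set τ : ℂ := (h + I * z) / k with hτ
  set τ₁ : ℂ := (h' + I / z) / k with hτ₁
  have hτim : 0 < τ.im := im_cusp_pos hk (by simp) hz
  have hτ₁im : 0 < τ₁.im := im_cusp_pos hk (by simp) (inv_re_pos hz)
  -- The lattice `ℤ + ℤ τ` is `I z (ℤ + ℤ τ₁)`.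
  have hb₁ : I * z = (k : ℤ) * τ + (-h : ℤ) := by
    rw [hτ]
    push_cast
    field_simp
    ring
  have hb₂ : I * z * τ₁ = h' * τ + (-k' : ℤ) := by
    rw [hτ, hτ₁]
    push_cast
    field_simp
    linear_combination -hdc + I_sq
  have hτk : k * τ = h + I * z := by
    rw [hτ]
    field_simp
  have hτ₁k : k * z * τ₁ = z * h' + I := by
    rw [hτ₁]
    field_simp
  -- The entries of a column or row of a matrix of determinant one are not both even, which
  -- makes the signs in the factors of automorphy agree.
  have hodd₁ : Odd (k : ℤ) ∨ Odd h := by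
    by_contra! hcon
    obtain ⟨⟨a, ha⟩, ⟨b, hb⟩⟩ := And.imp Int.not_odd_iff_even.mp Int.not_odd_iff_even.mp hcon
    rw [ha, hb] at hd
    have : (2 : ℤ) * (a * k' - b * h') = 1 := by linarith
    omega
  have hodd₂ : Odd h' ∨ Odd k' := by
    by_contra! hcon
    obtain ⟨⟨a, ha⟩, ⟨b, hb⟩⟩ := And.imp Int.not_odd_iff_even.mp Int.not_odd_iff_even.mp hcon
    rw [ha, hb] at hd
    have : (2 : ℤ) * (k * b - h * a) = 1 := by linarith
    omega
  set f : ℂ → ℂ := fun v => cexp (-(Real.pi * k * z * v ^ 2)) * thetaQuot τ (I * z * v) with hf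
  have hθ := differentiable_thetaQuot hτim
  have hfd : Differentiable ℂ f := by
    refine Differentiable.mul (by fun_prop) (hθ.comp (by fun_prop))
  have hf0 : ∀ u, f u = 0 → thetaQuot τ (I * z * u) = 0 := fun u hu =>
    (mul_eq_zero.mp hu).resolve_left (Complex.exp_ne_zero _)
  have hfder : ∀ u, thetaQuot τ (I * z * u) = 0 → HasDerivAt f
      (cexp (-(Real.pi * k * z * u ^ 2)) * (deriv (thetaQuot τ) (I * z * u) * (I * z))) u := by
    intro u hu
    have h1 : HasDerivAt (fun v : ℂ => I * z * v) (I * z) u := by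
      simpa using (hasDerivAt_id u).const_mul (I * z)
    have h2 := (hθ (I * z * u)).hasDerivAt.comp u h1
    have h3 : HasDerivAt (fun v : ℂ => cexp (-(Real.pi * k * z * v ^ 2))) _ u :=
      DifferentiableAt.hasDerivAt (by fun_prop)
    have h4 := h3.mul h2
    simp only [Function.comp_apply, hu, mul_zero, zero_add] at h4
    exact h4
  obtain ⟨c, hc⟩ := eq_const_mul_of_quasiperiodic (f := f) (g := thetaQuot τ₁)
    (E₁ := fun _ => -1) (E₂ := fun u => -cexp (-(Real.pi * I * τ₁) - 2 * Real.pi * I * u)) hτ₁im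
    hfd (differentiable_thetaQuot hτ₁im)
    (by
      intro u hu
      obtain ⟨m, n, hmn⟩ := thetaQuot_eq_zero hτim (hf0 u hu)
      rw [(hfder u (hf0 u hu)).deriv, hmn]
      exact mul_ne_zero (Complex.exp_ne_zero _)
        (mul_ne_zero (deriv_thetaQuot_lattice hτim m n) hIz))
    (by
      intro u hu
      obtain ⟨m, n, hmn⟩ := thetaQuot_eq_zero hτim (hf0 u hu)
      have : u = (-(h * m + k * n : ℤ)) * τ₁ + (k' * m + h' * n : ℤ) := by
        apply mul_left_cancel₀ hIz
        rw [mul_add, mul_left_comm, hb₂, mul_comm (I * z) (((k' * m + h' * n : ℤ)) : ℂ), hmn, hb₁]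
        push_cast
        linear_combination (m * τ + n) * hdc
      rw [this]
      exact_mod_cast thetaQuot_lattice hτ₁im (-(h * m + k * n)) (k' * m + h' * n))
    (fun u => by norm_num) (fun u => neg_ne_zero.mpr (Complex.exp_ne_zero _))
    (by
      intro u
      have e : I * z * (u + 1) = I * z * u + ((k : ℤ) * τ + (-h : ℤ)) := by
        rw [← hb₁]
        ring
      simp only [hf]
      have key : cexp (-(Real.pi * k * z * (u + 1) ^ 2)) *
          cexp (Real.pi * I * ((k : ℤ) + (-h : ℤ)) - Real.pi * I * (k : ℤ) ^ 2 * τ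
            - 2 * Real.pi * I * (k : ℤ) * (I * z * u))
          = -1 * cexp (-(Real.pi * k * z * u ^ 2)) := by
        rw [← exp_pi_mul_I_parity hodd₁, ← Complex.exp_add, ← Complex.exp_add]
        congr 1
        push_cast
        linear_combination (-Real.pi * I * k) * hτk
          + (-Real.pi * k * z - 2 * Real.pi * k * z * u) * I_sq
      rw [e, thetaQuot_add_lattice hτim]
      linear_combination thetaQuot τ (I * z * u) * key)
    (fun u => by rw [thetaQuot_add_one, neg_one_mul])
    (by
      intro u
      have e : I * z * (u + τ₁) = I * z * u + (h' * τ + (-k' : ℤ)) := by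
        rw [← hb₂]
        ring
      simp only [hf]
      have key : cexp (-(Real.pi * k * z * (u + τ₁) ^ 2)) *
          cexp (Real.pi * I * (h' + (-k' : ℤ)) - Real.pi * I * h' ^ 2 * τ
            - 2 * Real.pi * I * h' * (I * z * u))
          = -1 * (cexp (-(Real.pi * I * τ₁) - 2 * Real.pi * I * u) *
            cexp (-(Real.pi * k * z * u ^ 2))) := by
        rw [← exp_pi_mul_I_parity hodd₂, ← Complex.exp_add, ← Complex.exp_add, ← Complex.exp_add]
        congr 1
        push_cast at hb₂ ⊢
        linear_combination (-Real.pi * (2 * u + τ₁)) * hτ₁k + (Real.pi * I * h') * hb₂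
          + (-2 * Real.pi * u * z * h' - Real.pi * τ₁ * z * h') * I_sq
      rw [e, thetaQuot_add_lattice hτim]
      linear_combination thetaQuot τ (I * z * u) * key)
    (fun u => thetaQuot_add_tau hτ₁im u)
  have hc' : c * (I * z) = 1 := by
    have h1 := hasDerivAt_thetaQuot_zero hτ₁im
    have h2 := (hfder 0 (by rw [mul_zero, thetaQuot_zero])).const_mul c
    have h3 : thetaQuot τ₁ = fun u => c * f u := funext hc
    rw [h3] at h1
    have h4 := h1.unique h2
    rw [mul_zero, (hasDerivAt_thetaQuot_zero hτim).deriv] at h4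
    have hpi : (Real.pi : ℂ) ≠ 0 := by simp [Real.pi_ne_zero]
    apply mul_left_cancel₀ hpi
    simp only [ne_eq, OfNat.ofNat_ne_zero, not_false_eq_true, zero_pow, mul_zero, neg_zero,
      Complex.exp_zero, one_mul] at h4
    linear_combination -h4
  rw [hc v]
  simp only [hf]
  have e : cexp (Real.pi * k * z * v ^ 2) * cexp (-(Real.pi * k * z * v ^ 2)) = 1 := by
    rw [← Complex.exp_add, add_neg_cancel, Complex.exp_zero]
  linear_combination (-(thetaQuot τ (I * z * v))) * (c * I * z * e + hc')

/-- The transformation law of `η` restated for `(q; q)_∞`. -/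
lemma eulerProd_cusp {k : ℕ} (hk : 0 < k) {h h' k' : ℤ} (hd : h * h' + 1 = k * k') {z : ℂ}
    (hz : 0 < z.re) :
    eulerProd ((h' + I / z) / k) =
      omega h k * Complex.sqrt z * cexp (Real.pi / (12 * k) * (z⁻¹ - z)) *
        eulerProd ((h + I * z) / k) := by
  have hk0 : (k : ℂ) ≠ 0 := by exact_mod_cast hk.ne'
  have hz0 := ne_zero_of_re_pos hz
  have := eta_cusp k hk h h' ⟨k', hd⟩ z hz
  rw [eta_eq_eulerProd, eta_eq_eulerProd] at this
  apply mul_left_cancel₀ (Complex.exp_ne_zero (Real.pi * I * ((h' + I / z) / k) / 12))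
  rw [this]
  have e : cexp (Real.pi * I * ((h' + I / z) / k) / 12) * cexp (Real.pi / (12 * k) * (z⁻¹ - z)) =
      cexp (Real.pi * I * (h' - h) / (12 * k)) * cexp (Real.pi * I * ((h + I * z) / k) / 12) := by
    rw [← Complex.exp_add, ← Complex.exp_add]
    congr 1
    field_simp
    linear_combination (1 - z ^ 2) * I_sq
  linear_combination (-(omega h k * Complex.sqrt z * eulerProd ((h + I * z) / k))) * e

/-! ### A finite partial fraction expansion -/

lemma qPow_add (τ s t : ℂ) : qPow τ (s + t) = qPow τ s * qPow τ t := by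
  unfold qPow
  rw [← Complex.exp_add]
  ring_nf

lemma qPow_neg (τ s : ℂ) : qPow τ (-s) = (qPow τ s)⁻¹ := by
  unfold qPow
  rw [← Complex.exp_neg]
  ring_nf

lemma qPow_zero (τ : ℂ) : qPow τ 0 = 1 := by simp [qPow]

lemma qPow_ne_zero (τ s : ℂ) : qPow τ s ≠ 0 := Complex.exp_ne_zero _

lemma qPow_eq_expI (τ s : ℂ) : qPow τ s = expI (s * τ) := by
  unfold qPow expI
  ring_nf

lemma qPow_natCast (τ : ℂ) (n : ℕ) : qPow τ n = expI τ ^ n := by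
  rw [qPow_eq_expI, expI_pow]

lemma qPow_natCast_ne_one {τ : ℂ} (hτ : 0 < τ.im) {n : ℕ} (hn : n ≠ 0) : qPow τ n ≠ 1 := by
  intro h
  have h1 := congrArg norm h
  rw [qPow_natCast, norm_pow, norm_one] at h1
  exact (pow_lt_one₀ (norm_nonneg _) (norm_expI_lt_one hτ) hn).ne h1

/-- Partial fraction expansion of `y ^ N / ∏_{i ≤ M} (1 - y q^i)`: Lagrange interpolation of the
monomial `X ^ N` at the nodes `q^{-i}`. -/
lemma pow_eq_prod_mul_sum {τ : ℂ} (hτ : 0 < τ.im) {y : ℂ} {N M : ℕ} (hNM : N ≤ M)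
    (hy : ∀ i ∈ Finset.range (M + 1), y * qPow τ i ≠ 1) :
    y ^ N = (∏ i ∈ Finset.range (M + 1), (1 - y * qPow τ i)) *
      ∑ i ∈ Finset.range (M + 1), qPow τ (-(i * N)) /
        ((∏ j ∈ (Finset.range (M + 1)).erase i, (1 - qPow τ (j - i))) * (1 - y * qPow τ i)) := by
  set s := Finset.range (M + 1)
  set v : ℕ → ℂ := fun i => qPow τ (-i) with hv
  have hinj : Function.Injective v := by
    intro i j hij
    wlog hlt : i ≤ j generalizing i j
    · exact (this hij.symm (by omega)).symm
    by_contra hne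
    refine qPow_natCast_ne_one hτ (n := j - i) (by omega) ?_
    simp only [hv] at hij
    rw [Nat.cast_sub hlt, sub_eq_add_neg, qPow_add, hij, ← qPow_add, add_neg_cancel, qPow_zero]
  have hv1 : ∀ i : ℕ, qPow τ i * v i = 1 := fun i => by
    simp only [hv]
    rw [← qPow_add, add_neg_cancel, qPow_zero]
  have hfac : ∀ i, y - v i = -v i * (1 - y * qPow τ i) := fun i => by
    linear_combination (-y) * hv1 i
  have hyv : ∀ i ∈ s, y ≠ v i := by
    intro i hi h
    exact hy i hi (by rw [h, mul_comm, hv1])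
  have hdeg : ((Polynomial.X : Polynomial ℂ) ^ N).degree < s.card := by
    rw [Polynomial.degree_X_pow, Finset.card_range]
    exact_mod_cast Nat.lt_succ_of_le hNM
  have h1 := congrArg (Polynomial.eval y) (Lagrange.eq_interpolate hinj.injOn hdeg)
  rw [Lagrange.eval_interpolate_not_at_node _ hyv, Lagrange.eval_nodal] at h1
  simp only [Polynomial.eval_pow, Polynomial.eval_X] at h1
  rw [h1, Finset.mul_sum, Finset.mul_sum]
  refine Finset.sum_congr rfl fun i hi => ?_
  have e1 : ∀ j, v i - v j = -v j * (1 - qPow τ (j - i)) := fun j => by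
    have : qPow τ (j - i) = qPow τ j * v i := by
      rw [sub_eq_add_neg, qPow_add]
    rw [this]
    linear_combination (-v i) * hv1 j
  have e2 : v i ^ N = qPow τ (-(i * N)) := by
    simp only [hv]
    rw [qPow_eq_expI, expI_pow, qPow_eq_expI]
    ring_nf
  have hvne : ∀ j, -v j ≠ 0 := fun j => neg_ne_zero.mpr (qPow_ne_zero _ _)
  rw [Lagrange.nodalWeight_eq_eval_nodal_erase_inv, Lagrange.eval_nodal, e2,
    Finset.prod_congr rfl (fun j _ => e1 j), Finset.prod_mul_distrib,
    Finset.prod_congr rfl (fun j _ => hfac j), Finset.prod_mul_distrib, hfac i,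
    ← Finset.mul_prod_erase s (fun j => -v j) hi]
  have hp : ∏ j ∈ s.erase i, -v j ≠ 0 := Finset.prod_ne_zero_iff.mpr fun j _ => hvne j
  have hvi : v i ≠ 0 := qPow_ne_zero _ _
  have h3 : 1 - y * qPow τ i ≠ 0 := sub_ne_zero.mpr (hy i hi).symm
  generalize ∏ j ∈ s.erase i, -v j = A at hp ⊢
  generalize ∏ j ∈ s.erase i, (1 - qPow τ (j - i)) = B
  rcases eq_or_ne B 0 with rfl | hB
  · simp
  field_simp

/-- Inverting the factors with negative exponents: `1 - x q^{-l} = -x q^{-l} (1 - x⁻¹ q^l)`. -/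
lemma prod_one_sub_mul_qPow_neg (τ : ℂ) {x : ℂ} (hx : x ≠ 0) (n : ℕ) :
    ∏ l ∈ Finset.range n, (1 - x * qPow τ (-(l + 1))) =
      (-x) ^ n * qPow τ (-(n * (n + 1) / 2)) *
        ∏ l ∈ Finset.range n, (1 - x⁻¹ * qPow τ (l + 1)) := by
  induction n with
  | zero => simp [qPow_zero]
  | succ n ih =>
    rw [Finset.prod_range_succ, Finset.prod_range_succ, ih]
    have e1 : qPow τ (-(((n + 1 : ℕ) : ℂ) * ((n + 1 : ℕ) + 1) / 2)) =
        qPow τ (-(n * (n + 1) / 2)) * qPow τ (-(n + 1)) := by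
      rw [← qPow_add]
      congr 1
      push_cast
      ring
    have e2 : qPow τ (-(n + 1)) * qPow τ (n + 1) = 1 := by
      rw [← qPow_add, neg_add_cancel, qPow_zero]
    have e3 : 1 - x * qPow τ (-(n + 1)) =
        -x * qPow τ (-(n + 1)) * (1 - x⁻¹ * qPow τ (n + 1)) := by
      have : x * x⁻¹ = 1 := mul_inv_cancel₀ hx
      linear_combination (-x * x⁻¹) * e2 - this
    rw [e1, e3]
    ring

/-- The finite product `(q; q)_m`. -/
def eulerPartial (τ : ℂ) (m : ℕ) : ℂ := ∏ l ∈ Finset.range m, (1 - qPow τ (l + 1))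

lemma eulerPartial_ne_zero {τ : ℂ} (hτ : 0 < τ.im) (m : ℕ) : eulerPartial τ m ≠ 0 := by
  refine Finset.prod_ne_zero_iff.mpr fun l _ => sub_ne_zero.mpr ?_
  have := qPow_natCast_ne_one hτ (Nat.succ_ne_zero l)
  push_cast at this
  exact this.symm

/-- The denominators of the Lagrange basis at the nodes `q^{-i}`. -/
lemma prod_erase_one_sub_qPow (τ : ℂ) {i M : ℕ} (hi : i ≤ M) :
    ∏ j ∈ (Finset.range (M + 1)).erase i, (1 - qPow τ (j - i)) =
      (-1) ^ i * qPow τ (-(i * (i + 1) / 2)) * eulerPartial τ i * eulerPartial τ (M - i) := by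
  obtain ⟨m, rfl⟩ := Nat.exists_eq_add_of_le hi
  have h1 : ∏ j ∈ (Finset.range (i + m + 1)).erase i, (1 - qPow τ (j - i)) =
      ∏ j ∈ Finset.range (i + (1 + m)), (if j = i then 1 else 1 - qPow τ (j - i)) := by
    rw [show i + (1 + m) = i + m + 1 by ring,
      ← Finset.mul_prod_erase (Finset.range (i + m + 1)) _ (Finset.mem_range.mpr (by omega : i < _)),
      if_pos rfl, one_mul]
    refine Finset.prod_congr rfl fun j hj => ?_
    rw [if_neg (Finset.ne_of_mem_erase hj)]
  have h2 := prod_one_sub_mul_qPow_neg τ one_ne_zero i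
  simp only [one_mul, inv_one] at h2
  rw [h1, Finset.prod_range_add, Finset.prod_range_add, Finset.prod_range_one, if_pos (add_zero i),
    one_mul, Nat.add_sub_cancel_left]
  unfold eulerPartial
  rw [← h2, ← Finset.prod_range_reflect]
  congr 1
  · refine Finset.prod_congr rfl fun j hj => ?_
    have hj' := Finset.mem_range.mp hj
    rw [if_neg (by omega), Nat.sub_sub, Nat.cast_sub (by omega)]
    push_cast
    ring_nf
  · refine Finset.prod_congr rfl fun j hj => ?_
    rw [if_neg (by omega)]
    push_cast
    ring_nf

/-- Finite version of the partial fraction expansion of the reciprocal theta function. -/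
lemma finite_reciprocal_theta {τ : ℂ} (hτ : 0 < τ.im) {x : ℂ} (hx : x ≠ 0)
    (hx₁ : ∀ n : ℕ, x * qPow τ n ≠ 1) (hx₂ : ∀ n : ℕ, x⁻¹ * qPow τ (n + 1) ≠ 1) (N : ℕ) :
    (∏ l ∈ Finset.range N, (1 - x⁻¹ * qPow τ (l + 1))) *
      (∏ l ∈ Finset.range (N + 1), (1 - x * qPow τ l)) *
      (∑ n ∈ Finset.range (N + 1), (-1) ^ n * qPow τ (n * (n + 1) / 2) / (1 - x * qPow τ n) *
          ((eulerPartial τ (N + n))⁻¹ * (eulerPartial τ (N - n))⁻¹) +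
        ∑ n ∈ Finset.range N, (-1) ^ n * (x⁻¹ * qPow τ ((n + 1) * (n + 2) / 2)) /
          (1 - x⁻¹ * qPow τ (n + 1)) *
          ((eulerPartial τ (N - 1 - n))⁻¹ * (eulerPartial τ (N + 1 + n))⁻¹)) = 1 := by
  -- Shifting the index by `N` turns `0, …, 2 N` into `-N, …, N`.
  set y := x * qPow τ (-N) with hy
  have hyl : ∀ n : ℕ, y * qPow τ (N + n : ℕ) = x * qPow τ n := fun n => by
    rw [hy, mul_assoc, ← qPow_add]
    push_cast
    ring_nf
  have hyr : ∀ n : ℕ, n < N → y * qPow τ (N - 1 - n : ℕ) = x * qPow τ (-(n + 1)) := fun n hn => by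
    rw [hy, mul_assoc, ← qPow_add, Nat.sub_sub, Nat.cast_sub (by omega)]
    push_cast
    ring_nf
  have hx₂' : ∀ n : ℕ, x * qPow τ (-(n + 1)) ≠ 1 := fun n h => hx₂ n (by
    rw [qPow_neg, mul_inv_eq_one₀ (qPow_ne_zero _ _)] at h
    rw [h, inv_mul_cancel₀ (qPow_ne_zero _ _)])
  have key := pow_eq_prod_mul_sum hτ (y := y) (N := N) (M := N + N) (by omega) (by
    intro i _
    rcases le_or_gt N i with hi | hi
    · obtain ⟨n, rfl⟩ := Nat.exists_eq_add_of_le hi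
      rw [hyl]
      exact hx₁ n
    · have := hyr (N - 1 - i) (by omega)
      rw [show N - 1 - (N - 1 - i) = i by omega] at this
      rw [this]
      exact hx₂' _)
  have hsum : ∑ i ∈ Finset.range (N + N + 1), qPow τ (-(i * N)) /
        ((∏ j ∈ (Finset.range (N + N + 1)).erase i, (1 - qPow τ (j - i))) * (1 - y * qPow τ i)) =
      ∑ i ∈ Finset.range (N + N + 1), qPow τ (-(i * N)) /
        (((-1) ^ i * qPow τ (-(i * (i + 1) / 2)) * eulerPartial τ i * eulerPartial τ (N + N - i))
          * (1 - y * qPow τ i)) :=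
    Finset.sum_congr rfl fun i hi => by
      rw [prod_erase_one_sub_qPow τ (Nat.lt_succ_iff.mp (Finset.mem_range.mp hi))]
  rw [hsum, add_assoc, Finset.prod_range_add, Finset.sum_range_add,
    ← Finset.prod_range_reflect, ← Finset.sum_range_reflect] at key
  have hprod₁ : ∏ j ∈ Finset.range N, (1 - y * qPow τ (N - 1 - j : ℕ)) =
      (-x) ^ N * qPow τ (-(N * (N + 1) / 2)) *
        ∏ l ∈ Finset.range N, (1 - x⁻¹ * qPow τ (l + 1)) := by
    rw [← prod_one_sub_mul_qPow_neg τ hx]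
    exact Finset.prod_congr rfl fun j hj => by rw [hyr j (Finset.mem_range.mp hj)]
  have hprod₂ : ∏ j ∈ Finset.range (N + 1), (1 - y * qPow τ (N + j : ℕ)) =
      ∏ l ∈ Finset.range (N + 1), (1 - x * qPow τ l) :=
    Finset.prod_congr rfl fun j _ => by rw [hyl]
  rw [hprod₁, hprod₂] at key
  have hpow : ∀ s t : ℂ, s = t → qPow τ s = qPow τ t := fun s t h => by rw [h]
  have hsum₁ : ∀ j ∈ Finset.range (N + 1), qPow τ (-((N + j : ℕ) * N)) /
      (((-1) ^ (N + j) * qPow τ (-((N + j : ℕ) * ((N + j : ℕ) + 1) / 2)) * eulerPartial τ (N + j) *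
        eulerPartial τ (N + N - (N + j))) * (1 - y * qPow τ (N + j : ℕ))) =
      ((-1) ^ N * qPow τ (N * (N + 1) / 2 - N ^ 2)) *
        ((-1) ^ j * qPow τ (j * (j + 1) / 2) / (1 - x * qPow τ j) *
          ((eulerPartial τ (N + j))⁻¹ * (eulerPartial τ (N - j))⁻¹)) := by
    intro j hj
    have h1 := sub_ne_zero.mpr (hx₁ j).symm
    have h2 := eulerPartial_ne_zero hτ (N + j)
    have h3 := eulerPartial_ne_zero hτ (N - j)
    have h4 := qPow_ne_zero τ (-((N + j : ℕ) * ((N + j : ℕ) + 1) / 2))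
    have e : qPow τ (-((N + j : ℕ) * N)) = qPow τ (N * (N + 1) / 2 - N ^ 2) *
        qPow τ (j * (j + 1) / 2) * qPow τ (-((N + j : ℕ) * ((N + j : ℕ) + 1) / 2)) := by
      rw [← qPow_add, ← qPow_add]
      apply hpow
      push_cast
      ring
    rw [hyl, show N + N - (N + j) = N - j by omega, pow_add, e]
    generalize qPow τ (-((N + j : ℕ) * ((N + j : ℕ) + 1) / 2)) = A at h4 ⊢
    generalize qPow τ (j * (j + 1) / 2) = B
    generalize qPow τ (N * (N + 1) / 2 - N ^ 2) = C
    rcases neg_one_pow_eq_or ℂ N with hN | hN <;> rcases neg_one_pow_eq_or ℂ j with hj | hj <;>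
      rw [hN, hj] <;> field_simp
  have hsum₂ : ∀ j ∈ Finset.range N, qPow τ (-((N - 1 - j : ℕ) * N)) /
      (((-1) ^ (N - 1 - j) * qPow τ (-((N - 1 - j : ℕ) * ((N - 1 - j : ℕ) + 1) / 2)) *
        eulerPartial τ (N - 1 - j) * eulerPartial τ (N + N - (N - 1 - j))) *
        (1 - y * qPow τ (N - 1 - j : ℕ))) =
      ((-1) ^ N * qPow τ (N * (N + 1) / 2 - N ^ 2)) *
        ((-1) ^ j * (x⁻¹ * qPow τ ((j + 1) * (j + 2) / 2)) / (1 - x⁻¹ * qPow τ (j + 1)) *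
          ((eulerPartial τ (N - 1 - j))⁻¹ * (eulerPartial τ (N + 1 + j))⁻¹)) := by
    intro j hj
    have hj' := Finset.mem_range.mp hj
    have h1 := sub_ne_zero.mpr (hx₂ j).symm
    have h2 := eulerPartial_ne_zero hτ (N - 1 - j)
    have h3 := eulerPartial_ne_zero hτ (N + 1 + j)
    have h4 := qPow_ne_zero τ (-((N - 1 - j : ℕ) * ((N - 1 - j : ℕ) + 1) / 2))
    have h5 := qPow_ne_zero τ (-(j + 1))
    have e : qPow τ (-((N - 1 - j : ℕ) * N)) = qPow τ (N * (N + 1) / 2 - N ^ 2) *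
        qPow τ ((j + 1) * (j + 2) / 2) * qPow τ (-(j + 1)) *
          qPow τ (-((N - 1 - j : ℕ) * ((N - 1 - j : ℕ) + 1) / 2)) := by
      rw [← qPow_add, ← qPow_add, ← qPow_add]
      apply hpow
      rw [Nat.sub_sub, Nat.cast_sub (by omega)]
      push_cast
      ring
    have e2 : qPow τ (-(j + 1)) * qPow τ (j + 1) = 1 := by
      rw [← qPow_add, neg_add_cancel, qPow_zero]
    have e3 : 1 - x * qPow τ (-(j + 1)) =
        -x * qPow τ (-(j + 1)) * (1 - x⁻¹ * qPow τ (j + 1)) := by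
      have : x * x⁻¹ = 1 := mul_inv_cancel₀ hx
      linear_combination (-x * x⁻¹) * e2 - this
    have e4 : (-1 : ℂ) ^ N = -((-1) ^ (N - 1 - j) * (-1) ^ j) := by
      conv_lhs => rw [show N = (N - 1 - j) + j + 1 by omega, pow_add, pow_add]
      ring
    rw [hyr j hj', show N + N - (N - 1 - j) = N + 1 + j by omega, e, e3, e4]
    generalize qPow τ (-((N - 1 - j : ℕ) * ((N - 1 - j : ℕ) + 1) / 2)) = A at h4 ⊢
    generalize 1 - x⁻¹ * qPow τ (j + 1) = D at h1 ⊢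
    generalize qPow τ (-(j + 1)) = B at h5 ⊢
    generalize qPow τ ((j + 1) * (j + 2) / 2) = E
    generalize qPow τ (N * (N + 1) / 2 - N ^ 2) = C
    rcases neg_one_pow_eq_or ℂ (N - 1 - j) with hN | hN <;>
      rcases neg_one_pow_eq_or ℂ j with hj | hj <;> rw [hN, hj] <;> field_simp
  rw [Finset.sum_congr rfl hsum₁, Finset.sum_congr rfl hsum₂, ← Finset.mul_sum, ← Finset.mul_sum,
    ← mul_add, add_comm (∑ n ∈ Finset.range N, _)] at key
  have e5 : y ^ N = x ^ N * (qPow τ (-(N * (N + 1) / 2)) * qPow τ (N * (N + 1) / 2 - N ^ 2)) := by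
    rw [hy, mul_pow, ← qPow_add, qPow_eq_expI, expI_pow, qPow_eq_expI]
    ring_nf
  have h6 : x ^ N * (qPow τ (-(N * (N + 1) / 2)) * qPow τ (N * (N + 1) / 2 - N ^ 2)) ≠ 0 :=
    mul_ne_zero (pow_ne_zero _ hx) (mul_ne_zero (qPow_ne_zero _ _) (qPow_ne_zero _ _))
  apply mul_left_cancel₀ h6
  rw [e5, neg_pow x] at key
  rcases neg_one_pow_eq_or ℂ N with hN | hN <;> rw [hN] at key <;> linear_combination -key

/-! ### The reciprocal theta function and the crank functions -/

/-- Partial sums with coefficients that are uniformly bounded and converge termwise to `β`. -/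
lemma tendsto_sum_mul_of_dominated {a : ℕ → ℂ} (ha : Summable a) {b : ℕ → ℕ → ℂ} {C : ℝ} {β : ℂ}
    (hC : ∀ N n, ‖b N n‖ ≤ C) (hb : ∀ n, Tendsto (b · n) atTop (𝓝 β)) {s : ℕ → ℕ}
    (hs : Tendsto s atTop atTop) :
    Tendsto (fun N => ∑ n ∈ Finset.range (s N), a n * b N n) atTop (𝓝 ((∑' n, a n) * β)) := by
  have hC0 : 0 ≤ C := (norm_nonneg _).trans (hC 0 0)
  have h := tendsto_tsum_of_dominated_convergence (𝓕 := atTop)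
    (f := fun N n => if n < s N then a n * b N n else 0) (g := fun n => a n * β)
    (bound := fun n => ‖a n‖ * C) (ha.norm.mul_right C)
    (fun n => by
      refine ((hb n).const_mul (a n)).congr' ?_
      filter_upwards [hs.eventually_gt_atTop n] with N hN
      rw [if_pos hN])
    (.of_forall fun N n => by
      split_ifs
      · rw [norm_mul]
        exact mul_le_mul_of_nonneg_left (hC N n) (norm_nonneg _)
      · rw [norm_zero]
        positivity)
  rw [tsum_mul_right] at h
  refine h.congr fun N => ?_
  rw [tsum_eq_sum (s := Finset.range (s N)) fun n hn => if_neg (by simpa using hn)]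
  exact Finset.sum_congr rfl fun n hn => if_pos (Finset.mem_range.mp hn)

lemma tendsto_prod_qPochInf {τ : ℂ} (hτ : 0 < τ.im) (a : ℂ) :
    Tendsto (fun N => ∏ l ∈ Finset.range N, (1 - a * qPow τ l)) atTop
      (𝓝 (qPochInf a (expI τ))) := by
  simp only [qPow_natCast]
  exact (multipliable_qPochInf a (norm_expI_lt_one hτ)).tendsto_prod_tprod_nat

lemma tendsto_eulerPartial {τ : ℂ} (hτ : 0 < τ.im) :
    Tendsto (eulerPartial τ) atTop (𝓝 (eulerProd τ)) := by
  refine (tendsto_prod_qPochInf hτ (expI τ)).congr fun N => Finset.prod_congr rfl fun l _ => ?_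
  rw [add_comm, qPow_add, qPow_eq_expI τ 1, one_mul]

lemma exists_norm_inv_eulerPartial_le {τ : ℂ} (hτ : 0 < τ.im) :
    ∃ C : ℝ, 0 ≤ C ∧ ∀ m, ‖(eulerPartial τ m)⁻¹‖ ≤ C := by
  have h := (tendsto_eulerPartial hτ).inv₀ (eulerProd_ne_zero hτ)
  obtain ⟨C, hC⟩ := (Metric.isBounded_range_of_tendsto _ h).exists_norm_le
  exact ⟨C, (norm_nonneg _).trans (hC _ ⟨0, rfl⟩), fun m => hC _ ⟨m, rfl⟩⟩

lemma norm_qPow_ofReal (τ : ℂ) (s : ℝ) : ‖qPow τ s‖ = Real.exp (-(2 * Real.pi * (s * τ.im))) := by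
  rw [qPow_eq_expI, norm_expI, im_ofReal_mul]

lemma norm_qPow_le {τ : ℂ} (hτ : 0 < τ.im) {s : ℝ} {n : ℕ} (h : n ≤ s) :
    ‖qPow τ s‖ ≤ ‖expI τ‖ ^ n := by
  rw [← norm_pow, ← qPow_natCast, show ((n : ℕ) : ℂ) = ((n : ℝ) : ℂ) by norm_cast,
    norm_qPow_ofReal, norm_qPow_ofReal, Real.exp_le_exp]
  have := Real.pi_pos
  have : (n : ℝ) * τ.im ≤ s * τ.im := mul_le_mul_of_nonneg_right h hτ.le
  nlinarith

lemma summable_div_one_sub {τ : ℂ} (hτ : 0 < τ.im) (w : ℂ)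
    {t : ℕ → ℂ} {C : ℝ} (ht : ∀ n, ‖t n‖ ≤ C * ‖expI τ‖ ^ n) :
    Summable fun n : ℕ => t n / (1 - w * qPow τ n) := by
  have hq := norm_expI_lt_one hτ
  have h1 : Tendsto (fun n : ℕ => (1 - w * qPow τ n)⁻¹) atTop (𝓝 1) := by
    have : Tendsto (fun n : ℕ => 1 - w * qPow τ n) atTop (𝓝 (1 - w * 0)) := by
      simp only [qPow_natCast]
      exact ((tendsto_pow_atTop_nhds_zero_of_norm_lt_one hq).const_mul w).const_sub 1
    simpa using this.inv₀ (by simp)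
  obtain ⟨K, hK⟩ := (Metric.isBounded_range_of_tendsto _ h1).exists_norm_le
  refine Summable.of_norm_bounded
    (((summable_geometric_of_lt_one (norm_nonneg _) hq).mul_left C).mul_right K) fun n => ?_
  rw [div_eq_mul_inv, norm_mul]
  exact mul_le_mul (ht n) (hK _ ⟨n, rfl⟩) (norm_nonneg _) ((norm_nonneg _).trans (ht n))

/-- The partial fraction expansion
`∑_{n ∈ ℤ} (-1)^n q^{n(n+1)/2} / (1 - x q^n) = (q)_∞² / ((x; q)_∞ (x⁻¹ q; q)_∞)` of the reciprocal
theta function. The terms with `n < 0` are written with positive powers of `q`. -/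
theorem reciprocal_theta {τ : ℂ} (hτ : 0 < τ.im) {x : ℂ} (hx : x ≠ 0)
    (hx₁ : ∀ n : ℕ, x * qPow τ n ≠ 1) (hx₂ : ∀ n : ℕ, x⁻¹ * qPow τ (n + 1) ≠ 1) :
    (∑' n : ℕ, (-1) ^ n * qPow τ (n * (n + 1) / 2) / (1 - x * qPow τ n)) +
      ∑' n : ℕ, (-1) ^ n * (x⁻¹ * qPow τ ((n + 1) * (n + 2) / 2)) / (1 - x⁻¹ * qPow τ (n + 1)) =
    eulerProd τ ^ 2 / (qPochInf x (expI τ) * qPochInf (x⁻¹ * expI τ) (expI τ)) := by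
  have hq := norm_expI_lt_one hτ
  have hs₁ : Summable fun n : ℕ =>
      (-1) ^ n * qPow τ (n * (n + 1) / 2) / (1 - x * qPow τ n) := by
    refine summable_div_one_sub hτ x (C := 1) fun n => ?_
    rw [norm_mul, norm_pow, norm_neg, norm_one, one_pow]
    have := norm_qPow_le hτ (s := (n * (n + 1) / 2 : ℝ)) (n := n) (by
      rcases Nat.eq_zero_or_pos n with rfl | hn
      · simp
      · have : (1 : ℝ) ≤ n := by exact_mod_cast hn
        nlinarith)
    push_cast at this
    linarith
  have hstep : ∀ n : ℕ, x⁻¹ * qPow τ (n + 1) = x⁻¹ * qPow τ 1 * qPow τ n := fun n => by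
    rw [add_comm, qPow_add, mul_assoc]
  have hs₂ : Summable fun n : ℕ => (-1) ^ n * (x⁻¹ * qPow τ ((n + 1) * (n + 2) / 2)) /
      (1 - x⁻¹ * qPow τ (n + 1)) := by
    simp only [hstep]
    refine summable_div_one_sub hτ (x⁻¹ * qPow τ 1)
      (C := ‖x⁻¹‖) fun n => ?_
    rw [norm_mul, norm_pow, norm_neg, norm_one, one_pow, one_mul, norm_mul]
    have := norm_qPow_le hτ (s := ((n + 1) * (n + 2) / 2 : ℝ)) (n := n) (by
      have : (0 : ℝ) ≤ n := Nat.cast_nonneg n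
      nlinarith)
    push_cast at this
    exact mul_le_mul_of_nonneg_left this (norm_nonneg _)
  obtain ⟨C, hC0, hC⟩ := exists_norm_inv_eulerPartial_le hτ
  have hE := (tendsto_eulerPartial hτ).inv₀ (eulerProd_ne_zero hτ)
  have hCC : ∀ m n, ‖(eulerPartial τ m)⁻¹ * (eulerPartial τ n)⁻¹‖ ≤ C * C := fun m n => by
    rw [norm_mul]
    exact mul_le_mul (hC m) (hC n) (norm_nonneg _) hC0
  have ht₁ := tendsto_sum_mul_of_dominated hs₁ (s := fun N => N + 1)
    (b := fun N n => (eulerPartial τ (N + n))⁻¹ * (eulerPartial τ (N - n))⁻¹)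
    (fun N n => hCC _ _)
    (fun n => (hE.comp (tendsto_add_atTop_nat n)).mul (hE.comp (tendsto_sub_atTop_nat n)))
    (tendsto_add_atTop_nat 1)
  have ht₂ := tendsto_sum_mul_of_dominated hs₂ (s := fun N => N)
    (b := fun N n => (eulerPartial τ (N - 1 - n))⁻¹ * (eulerPartial τ (N + 1 + n))⁻¹)
    (fun N n => hCC _ _)
    (fun n => (hE.comp ((tendsto_sub_atTop_nat n).comp (tendsto_sub_atTop_nat 1))).mul
      (hE.comp ((tendsto_add_atTop_nat n).comp (tendsto_add_atTop_nat 1))))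
    tendsto_id
  have hp₁ : Tendsto (fun N => ∏ l ∈ Finset.range N, (1 - x⁻¹ * qPow τ (l + 1))) atTop
      (𝓝 (qPochInf (x⁻¹ * expI τ) (expI τ))) := by
    refine (tendsto_prod_qPochInf hτ (x⁻¹ * expI τ)).congr fun N =>
      Finset.prod_congr rfl fun l _ => ?_
    rw [hstep, qPow_eq_expI τ 1, one_mul]
  have hp₂ := (tendsto_prod_qPochInf hτ x).comp (tendsto_add_atTop_nat 1)
  have hlim := (hp₁.mul hp₂).mul (ht₁.add ht₂)
  have hone := tendsto_nhds_unique (hlim.congr fun N => finite_reciprocal_theta hτ hx hx₁ hx₂ N)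
    tendsto_const_nhds
  have h1 : qPochInf x (expI τ) ≠ 0 := qPochInf_ne_zero hq fun i => by
    rw [← qPow_natCast]
    exact hx₁ i
  have h2 : qPochInf (x⁻¹ * expI τ) (expI τ) ≠ 0 := qPochInf_ne_zero hq fun i => by
    have := hx₂ i
    rwa [hstep, qPow_eq_expI τ 1, one_mul, qPow_natCast] at this
  have h3 := eulerProd_ne_zero hτ
  rw [← add_mul, ← mul_inv, ← mul_assoc, mul_inv_eq_one₀ (mul_ne_zero h3 h3)] at hone
  rw [eq_div_iff (mul_ne_zero h1 h2)]
  linear_combination hone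

/-- The point `a / c - (b / c) τ` with `0 < b < c` is not in `ℤ + ℤ τ`. -/
lemma expI_neg_mul_qPow_ne_one {τ : ℂ} (hτ : 0 < τ.im) {a b : ℤ} {c : ℕ} (hb : 0 < b)
    (hbc : b < c) (n : ℤ) : expI (-((a : ℂ) / c - b / c * τ)) * qPow τ n ≠ 1 := by
  intro h
  rw [qPow_eq_expI, ← expI_add, expI_eq_one_iff] at h
  obtain ⟨m, hm⟩ := h
  have hc0 : (0 : ℝ) < c := by
    have : (0 : ℤ) < c := hb.trans hbc
    exact_mod_cast this
  have hcC : (c : ℂ) ≠ 0 := by exact_mod_cast hc0.ne'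
  have e : ((b + n * c : ℝ) : ℂ) * τ = ((m * c + a : ℝ) : ℂ) := by
    push_cast
    field_simp at hm
    linear_combination hm
  have e1 := congrArg Complex.im e
  rw [im_ofReal_mul, ofReal_im] at e1
  have e2 : (b : ℝ) + n * c = 0 := (mul_eq_zero.mp e1).resolve_right hτ.ne'
  have e3 : b + n * c = 0 := by exact_mod_cast e2
  have hn : (0 : ℤ) < -n := by
    by_contra! hn
    nlinarith
  nlinarith

/-- `C(a, b, c; q)` is a reciprocal theta function at the point `a / c - (b / c) τ`. -/
theorem crankLerch_eq {τ : ℂ} (hτ : 0 < τ.im) {a b : ℤ} {c : ℕ} (hb : 0 < b) (hbc : b < c) :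
    crankLerch a b c τ = 1 / (4 * eulerProd τ * thetaQuot τ ((a : ℂ) / c - b / c * τ)) := by
  set U : ℂ := (a : ℂ) / c - b / c * τ with hU
  set x := expI (-U) with hx
  -- The factor common to all terms of the two series; it turns `(1 - x)⁻¹` into a sine.
  set κ := expI (-(U / 2)) with hκ
  have hx0 : x ≠ 0 := expI_ne_zero _
  have hx₁ : ∀ n : ℕ, x * qPow τ n ≠ 1 := fun n => by
    have := expI_neg_mul_qPow_ne_one hτ (a := a) hb hbc n
    rwa [Int.cast_natCast] at this
  have hx₂ : ∀ n : ℕ, x⁻¹ * qPow τ (n + 1) ≠ 1 := fun n h => by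
    apply expI_neg_mul_qPow_ne_one hτ (a := a) hb hbc (-(n + 1))
    push_cast
    rw [qPow_neg]
    have h' : qPow τ (n + 1) = x := by
      field_simp at h
      exact h
    rw [h', mul_inv_cancel₀ hx0]
  have hS := reciprocal_theta hτ hx0 hx₁ hx₂
  have hκ0 : κ ≠ 0 := expI_ne_zero _
  have e1 : ∀ m : ℕ, (-1 : ℂ) ^ m * cexp (-(Real.pi * I * a / c)) *
      qPow τ ((m : ℂ) * (m + 1) / 2 + b / (2 * c)) /
        (1 - cexp (-(2 * Real.pi * I * a / c)) * qPow τ ((m : ℂ) + b / c)) =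
      κ * ((-1) ^ m * qPow τ (m * (m + 1) / 2) / (1 - x * qPow τ m)) := fun m => by
    have h1 : cexp (-(2 * Real.pi * I * a / c)) * qPow τ ((m : ℂ) + b / c) = x * qPow τ m := by
      rw [hx, hU]
      unfold qPow expI
      rw [← Complex.exp_add, ← Complex.exp_add]
      ring_nf
    have h2 : cexp (-(Real.pi * I * a / c)) * qPow τ ((m : ℂ) * (m + 1) / 2 + b / (2 * c)) =
        κ * qPow τ (m * (m + 1) / 2) := by
      rw [hκ, hU]
      unfold qPow expI
      rw [← Complex.exp_add, ← Complex.exp_add]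
      ring_nf
    rw [h1, mul_assoc, h2]
    ring
  have e2 : ∀ m : ℕ, (-1 : ℂ) ^ (m + 1) * cexp (Real.pi * I * a / c) *
      qPow τ (((m : ℂ) + 1) * (m + 2) / 2 - b / (2 * c)) /
        (1 - cexp (2 * Real.pi * I * a / c) * qPow τ ((m : ℂ) + 1 - b / c)) =
      -κ * ((-1) ^ m * (x⁻¹ * qPow τ ((m + 1) * (m + 2) / 2)) /
        (1 - x⁻¹ * qPow τ (m + 1))) := fun m => by
    have h1 : cexp (2 * Real.pi * I * a / c) * qPow τ ((m : ℂ) + 1 - b / c) =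
        x⁻¹ * qPow τ (m + 1) := by
      rw [hx, hU, ← expI_neg]
      unfold qPow expI
      rw [← Complex.exp_add, ← Complex.exp_add]
      ring_nf
    have h2 : cexp (Real.pi * I * a / c) * qPow τ (((m : ℂ) + 1) * (m + 2) / 2 - b / (2 * c)) =
        κ * (x⁻¹ * qPow τ ((m + 1) * (m + 2) / 2)) := by
      rw [hκ, hx, hU, ← expI_neg]
      unfold qPow expI
      rw [← Complex.exp_add, ← Complex.exp_add, ← Complex.exp_add]
      ring_nf
    rw [h1, mul_assoc, h2, pow_succ]
    ring
  unfold crankLerch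
  simp only [e1, e2]
  rw [tsum_mul_left, tsum_mul_left, neg_mul, sub_neg_eq_add, ← mul_add, hS,
    qPow_eq_expI τ 1, one_mul, qPochInf_eq_mul x (norm_expI_lt_one hτ)]
  unfold thetaQuot
  have h1 : expI (U / 2) = κ⁻¹ := by
    rw [hκ, expI_neg, inv_inv]
  have h2 : expI U = x⁻¹ := by
    rw [hx, expI_neg, inv_inv]
  rw [sin_pi_mul, h1, h2, inv_inv]
  change I / (2 * eulerProd τ) * _ = _
  have h3 := eulerProd_ne_zero hτ
  have h4 : 1 - x ≠ 0 := sub_ne_zero.mpr fun h => by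
    have := hx₁ 0
    rw [Nat.cast_zero, qPow_zero, mul_one] at this
    exact this h.symm
  generalize qPochInf (x * expI τ) (expI τ) = A
  generalize qPochInf (x⁻¹ * expI τ) (expI τ) = B
  rcases eq_or_ne A 0 with rfl | hA
  · simp
  rcases eq_or_ne B 0 with rfl | hB
  · simp
  field_simp
  ring

lemma sin_pi_mul_div_ne_zero {a : ℤ} {c : ℕ} (hc : 0 < c) (h : ¬ (c : ℤ) ∣ a) :
    Complex.sin (Real.pi * ((a : ℂ) / c)) ≠ 0 := by
  rw [Ne, Complex.sin_eq_zero_iff]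
  rintro ⟨n, hn⟩
  have hpi : (Real.pi : ℂ) ≠ 0 := by simp [Real.pi_ne_zero]
  have hcC : (c : ℂ) ≠ 0 := by exact_mod_cast hc.ne'
  rw [mul_comm (n : ℂ)] at hn
  have h1 := mul_left_cancel₀ hpi hn
  rw [div_eq_iff hcC] at h1
  exact h ⟨n, by rw [mul_comm]; exact_mod_cast h1⟩

/-- The transformation law of the crank generating function at `e(a / c)`, in terms of the
theta quotient at the image point `a h' / c - (a k / c) τ₁`, which is moved by the
lattice vector `n τ₁` to `a h' / c - (l / c) τ₁`. -/
theorem crankC_cusp {k c : ℕ} (hk : 0 < k) (hc : 0 < c) {h h' k' a l n : ℤ}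
    (hd : h * h' + 1 = k * k') (ha : ¬ (c : ℤ) ∣ a) (hl : a * k = l + c * n) {z : ℂ}
    (hz : 0 < z.re) :
    crankC (expI ((a : ℂ) / c)) (expI ((h + I * z) / k)) =
      -I * Complex.sin (Real.pi * ((a : ℂ) / c)) * omega h k / Complex.sqrt z *
        cexp (Real.pi / (12 * k) * (z⁻¹ - z)) *
        (cexp (Real.pi * I * n) *
          cexp (Real.pi * I * a ^ 2 * k * h' / c ^ 2 - 2 * Real.pi * I * n * a * h' / c) *
          qPow ((h' + I / z) / k) (-((l : ℂ) ^ 2 / (2 * c ^ 2)))) /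
        (eulerProd ((h' + I / z) / k) * thetaQuot ((h' + I / z) / k)
          (((a * h' : ℤ) : ℂ) / c - l / c * ((h' + I / z) / k))) := by
  have hk0 : (k : ℂ) ≠ 0 := by exact_mod_cast hk.ne'
  have hc0 : (c : ℂ) ≠ 0 := by exact_mod_cast hc.ne'
  have hz0 := ne_zero_of_re_pos hz
  have hτ : 0 < (((h : ℂ) + I * z) / k).im := im_cusp_pos hk (by simp) hz
  have hτ₁ : 0 < (((h' : ℂ) + I / z) / k).im := im_cusp_pos hk (by simp) (inv_re_pos hz)
  have hlc : (a : ℂ) * k = l + c * n := by exact_mod_cast hl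
  rw [crankC_eq hτ (sin_pi_mul_div_ne_zero hc ha)]
  have e1 : (a : ℂ) / c = I * z * (-I * a / (c * z)) := by
    field_simp
    linear_combination a * I_sq
  have hθ := thetaQuot_cusp hk hd hz (-I * a / (c * z))
  rw [← e1] at hθ
  have hφ := eulerProd_cusp hk hd hz
  set τ₁ : ℂ := (h' + I / z) / k with hτ₁def
  set U : ℂ := ((a * h' : ℤ) : ℂ) / c - l / c * τ₁ with hU
  have hτ₁k : k * z * τ₁ = z * h' + I := by
    rw [hτ₁def]
    field_simp
  clear_value τ₁
  have e2 : -I * a / (c * z) = U + (-n : ℤ) * τ₁ := by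
    rw [hU]
    push_cast
    have : n = (a * k - l : ℂ) / c := by
      rw [hlc]
      field_simp
      ring
    rw [this]
    field_simp
    linear_combination a * hτ₁k
  rw [e2, thetaQuot_add_mul_tau hτ₁, ← e2] at hθ
  have hφ0 := eulerProd_ne_zero hτ
  have hφ₁0 := eulerProd_ne_zero hτ₁
  have hω : omega h k ≠ 0 := Complex.exp_ne_zero _
  have hs : Complex.sqrt z ≠ 0 := by
    unfold Complex.sqrt
    simp [hz0]
  have hss : Complex.sqrt z * Complex.sqrt z = z := by
    unfold Complex.sqrt
    rw [← Complex.cpow_add _ _ hz0]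
    norm_num
  -- The Gaussian factor, the factor of automorphy of the shift by `-n τ₁` and the
  -- factor claimed cancel, since `(a k / c)² = (n + l / c)²`.
  have hexp : cexp (Real.pi * k * z * (-I * a / (c * z)) ^ 2) *
      cexp (Real.pi * I * (-n : ℤ) - Real.pi * I * (-n : ℤ) ^ 2 * τ₁ -
        2 * Real.pi * I * (-n : ℤ) * U) *
      (cexp (Real.pi * I * n) *
        cexp (Real.pi * I * a ^ 2 * k * h' / c ^ 2 - 2 * Real.pi * I * n * a * h' / c) *
        qPow τ₁ (-((l : ℂ) ^ 2 / (2 * c ^ 2)))) = 1 := by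
    unfold qPow
    rw [← Complex.exp_add, ← Complex.exp_add, ← Complex.exp_add, ← Complex.exp_add,
      ← Complex.exp_zero]
    congr 1
    have hzv : Real.pi * k * z * (-I * a / (c * z)) ^ 2 =
        Real.pi * I * k * (a / c) ^ 2 * (k * τ₁ - h') := by
      field_simp
      linear_combination (-a ^ 2 : ℂ) * hτ₁k
    rw [hzv, hU]
    push_cast
    field_simp
    linear_combination Real.pi * I * τ₁ * (a * k + l + c * n) * hlc
  set G := cexp (Real.pi * k * z * (-I * a / (c * z)) ^ 2)
  set F := cexp (Real.pi * I * (-n : ℤ) - Real.pi * I * (-n : ℤ) ^ 2 * τ₁ -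
        2 * Real.pi * I * (-n : ℤ) * U)
  set R := cexp (Real.pi * I * n) *
        cexp (Real.pi * I * a ^ 2 * k * h' / c ^ 2 - 2 * Real.pi * I * n * a * h' / c) *
        qPow τ₁ (-((l : ℂ) ^ 2 / (2 * c ^ 2)))
  have hG : G ≠ 0 := Complex.exp_ne_zero _
  have hF : F ≠ 0 := Complex.exp_ne_zero _
  have hE : cexp (Real.pi / (12 * k) * (z⁻¹ - z)) ≠ 0 := Complex.exp_ne_zero _
  have hR : R = (G * F)⁻¹ := eq_inv_of_mul_eq_one_right hexp
  rw [hθ, hφ, hR]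
  rw [hφ] at hφ₁0
  generalize thetaQuot τ₁ U = T
  rcases eq_or_ne T 0 with rfl | hT
  · simp
  generalize cexp (Real.pi / (12 * k) * (z⁻¹ - z)) = E at hE ⊢
  generalize eulerProd ((h + I * z) / k) = P at hφ0
  generalize Complex.sqrt z = s at hs hss
  subst hss
  field_simp
  linear_combination Complex.sin (Real.pi * a / c) * I_sq

/-- The sign `(-1)^{m + l}` is `(-1)^n` when `m = l + c n` with `c` odd. -/
lemma neg_one_pow_eq_exp {c : ℕ} (hc : Odd c) {m l : ℕ} {n : ℤ} (h : (m : ℤ) = l + c * n) :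
    (-1 : ℂ) ^ (m + l) = cexp (Real.pi * I * n) := by
  obtain ⟨r, rfl⟩ := hc
  have hm : (m : ℂ) = l + (2 * r + 1) * n := by exact_mod_cast h
  rw [← Complex.exp_pi_mul_I, ← Complex.exp_nat_mul]
  have : ((m + l : ℕ) : ℂ) * (Real.pi * I) =
      Real.pi * I * n + ((r * n + l : ℤ) : ℂ) * (2 * Real.pi * I) := by
    push_cast
    rw [hm]
    ring
  rw [this, Complex.exp_add, Complex.exp_int_mul_two_pi_mul_I, mul_one]

end CrankTrafo

end

open CrankTrafo Complex in
theorem proposition2p1 (a c h k : ℕ) (h' : ℤ) (z : ℂ)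
    (ha : 0 < a) (hac : a < c) (hcop : Nat.Coprime a c) (hc : Odd c)
    (hhk : h < k) (hcophk : Nat.Coprime h k)
    (hodd : Odd k → (h : ℤ) * h' ≡ -1 [ZMOD k])
    (heven : Even k → (h : ℤ) * h' ≡ -1 [ZMOD (2 * k)])
    (hz : 0 < z.re) :
    (c ∣ k →
      crankC (cexp (2 * Real.pi * I * a / c)) (cexp (2 * Real.pi * I / k * (h + I * z))) =
        I * Complex.sin (Real.pi * a / c) /
            (z ^ (1 / 2 : ℂ) * Complex.sin (Real.pi * a * h' / c)) *
          (-1 : ℂ) ^ (a * k + 1) * omega h k *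
          cexp (Real.pi / (12 * k) * (z⁻¹ - z) - Real.pi * I * a ^ 2 * k * h' / c ^ 2) *
          crankC (cexp (2 * Real.pi * I * a * h' / c))
            (cexp (2 * Real.pi * I / k * (h' + I / z)))) ∧
    (¬ c ∣ k → ∀ l : ℕ, 0 < l → l < c → l ≡ a * k [MOD c] →
      crankC (cexp (2 * Real.pi * I * a / c)) (cexp (2 * Real.pi * I / k * (h + I * z))) =
        4 * I * Complex.sin (Real.pi * a / c) * omega h k * (-1 : ℂ) ^ (a * k + l + 1) /
            z ^ (1 / 2 : ℂ) *
          cexp (-(Real.pi * I * a ^ 2 * h' * k / c ^ 2) +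
            2 * Real.pi * I * h' * l * a / c ^ 2) *
          qPow ((h' + I / z) / k) (-((l : ℂ) ^ 2 / (2 * c ^ 2))) *
          cexp (Real.pi / (12 * k) * (z⁻¹ - z)) *
          crankLerch (a * h') l c ((h' + I / z) / k)) := by
  have hk : 0 < k := by omega
  have hc0 : 0 < c := by omega
  have hcC : (c : ℂ) ≠ 0 := by exact_mod_cast hc0.ne'
  have hkC : (k : ℂ) ≠ 0 := by exact_mod_cast hk.ne'
  obtain ⟨k', hk'⟩ : (k : ℤ) ∣ h * h' + 1 := by
    rcases Nat.even_or_odd k with he | ho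
    · have := (Int.modEq_iff_dvd.mp (heven he).symm)
      rw [sub_neg_eq_add] at this
      exact (Dvd.intro_left 2 rfl).trans this
    · have := (Int.modEq_iff_dvd.mp (hodd ho).symm)
      rwa [sub_neg_eq_add] at this
  have hac' : ¬ (c : ℤ) ∣ (a : ℤ) := fun hd =>
    absurd (Nat.le_of_dvd ha (Int.natCast_dvd_natCast.mp hd)) (by omega)
  have hτ₁ : 0 < (((h' : ℂ) + I / z) / k).im := im_cusp_pos hk (by simp) (inv_re_pos hz)
  have e1 : cexp (2 * Real.pi * I * a / c) = expI (((a : ℤ) : ℂ) / c) := by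
    unfold expI
    push_cast
    ring_nf
  have e2 : cexp (2 * Real.pi * I / k * (h + I * z)) = expI ((((h : ℤ) : ℂ) + I * z) / k) := by
    unfold expI
    push_cast
    ring_nf
  have e3 : Complex.sin (Real.pi * a / c) = Complex.sin (Real.pi * (((a : ℤ) : ℂ) / c)) := by
    push_cast
    ring_nf
  have e4 : z ^ (1 / 2 : ℂ) = Complex.sqrt z := by
    rw [Complex.sqrt, one_div]
  rw [e1, e2, e3, e4]
  constructor
  · intro hck
    obtain ⟨n, rfl⟩ := hck
    have hn : ((a * (c * n) : ℕ) : ℤ) = (0 : ℕ) + c * ((a * n : ℕ) : ℤ) := by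
      push_cast
      ring
    rw [crankC_cusp hk hc0 (n := ((a * n : ℕ) : ℤ)) (l := 0) hk' hac' (by push_cast; ring) hz]
    have hndvd : ¬ (c : ℤ) ∣ ((a : ℤ) * h') := by
      intro hd
      have hcop1 : IsCoprime (c : ℤ) a := by
        rw [Nat.isCoprime_iff_coprime]
        exact hcop.symm
      have hd' := hcop1.dvd_of_dvd_mul_left hd
      have h1 : (c : ℤ) ∣ 1 := by
        have : (1 : ℤ) = c * (n * k') - h * h' := by
          push_cast at hk'
          linarith
        rw [this]
        exact dvd_sub (Dvd.intro _ rfl) (Dvd.dvd.mul_left hd' _)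
      have h2 : (c : ℤ) ≤ 1 := Int.le_of_dvd one_pos h1
      omega
    have hsin := sin_pi_mul_div_ne_zero hc0 hndvd
    have e5 : Complex.sin (Real.pi * a * h' / c) =
        Complex.sin (Real.pi * (((a : ℤ) * h' : ℤ) / c)) := by
      push_cast
      ring_nf
    have e6 : cexp (2 * Real.pi * I * a * h' / c) = expI (((a : ℤ) * h' : ℤ) / c) := by
      unfold expI
      push_cast
      ring_nf
    have e7 : cexp (2 * Real.pi * I / (c * n : ℕ) * (h' + I / z)) =
        expI ((h' + I / z) / (c * n : ℕ)) := by
      unfold expI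
      ring_nf
    have e8 := neg_one_pow_eq_exp hc (l := 0) hn
    rw [add_zero] at e8
    have e9 : qPow ((h' + I / z) / (c * n : ℕ)) (-(((0 : ℤ) : ℂ) ^ 2 / (2 * c ^ 2))) = 1 := by
      simp [qPow]
    have e10 : (((a : ℤ) * h' : ℤ) : ℂ) / c - ((0 : ℤ) : ℂ) / c * ((h' + I / z) / (c * n : ℕ)) =
        (((a : ℤ) * h' : ℤ) : ℂ) / c := by
      simp
    have e11 : cexp (Real.pi / (12 * (c * n : ℕ)) * (z⁻¹ - z) -
          Real.pi * I * a ^ 2 * (c * n : ℕ) * h' / c ^ 2) =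
        cexp (Real.pi / (12 * (c * n : ℕ)) * (z⁻¹ - z)) *
        cexp (Real.pi * I * ((a : ℤ) : ℂ) ^ 2 * (c * n : ℕ) * h' / c ^ 2 -
          2 * Real.pi * I * ((a * n : ℕ) : ℤ) * ((a : ℤ) : ℂ) * h' / c) := by
      rw [← Complex.exp_add]
      congr 1
      have : (n : ℂ) ≠ 0 := by
        rintro h0
        rw [Nat.cast_mul, h0, mul_zero] at hkC
        exact hkC rfl
      push_cast
      field_simp
      ring
    rw [e5, e6, e7, crankC_eq hτ₁ hsin, e9, e10, e11, pow_succ (-1 : ℂ), e8]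
    generalize Complex.sin (Real.pi * (((a : ℤ) * h' : ℤ) / c)) = s at hsin
    have hcancel : ∀ S w r e x E Q : ℂ, -I * S * w / r * E * (e * x * 1) / Q =
        I * S / (r * s) * (e * -1) * w * (E * x) * (s / Q) := by
      intro S w r e x E Q
      have : s * s⁻¹ = 1 := mul_inv_cancel₀ hsin
      simp only [div_eq_mul_inv, mul_inv]
      linear_combination (I * S * w * r⁻¹ * E * e * x * Q⁻¹) * this
    exact hcancel _ _ _ _ _ _ _
  · intro _ l hl0 hlc hmod
    obtain ⟨n, hn⟩ := Nat.modEq_iff_dvd.mp hmod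
    have hn' : ((a * k : ℕ) : ℤ) = l + c * n := by linarith
    rw [crankC_cusp hk hc0 (n := n) (l := l) hk' hac' (by exact_mod_cast hn') hz,
      crankLerch_eq hτ₁ (by exact_mod_cast hl0) (by exact_mod_cast hlc), pow_succ (-1 : ℂ),
      neg_one_pow_eq_exp hc hn']
    have e5 : cexp (-(Real.pi * I * a ^ 2 * h' * k / c ^ 2) +
          2 * Real.pi * I * h' * l * a / c ^ 2) =
        cexp (Real.pi * I * ((a : ℤ) : ℂ) ^ 2 * k * h' / c ^ 2 -
          2 * Real.pi * I * n * ((a : ℤ) : ℂ) * h' / c) := by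
      congr 1
      have hnc : (a : ℂ) * k = l + c * n := by exact_mod_cast hn'
      push_cast
      field_simp
      linear_combination (-2 * a * h') * hnc
    rw [e5]
    push_cast
    generalize thetaQuot _ _ = T
    generalize eulerProd _ = P
    rw [div_eq_mul_inv _ (P * T), div_eq_mul_inv _ (4 * P * T), mul_assoc 4 P T, mul_inv 4]
    ring
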